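/- **MFTR model.** Let $m,\mu,\sigma,E_s,N_0>0$, and $V_1,V_2,S\ge 0$ with $V_1^2+V_2^2+S>0$. Let $\zeta$ be Gamma distributed with unit mean and shape parameter $m$ (density $m^m x^{m-1}e^{-mx}/\Gamma(m)$, $x>0$), and let $\phi_1,\phi_2$ be uniform on $(0,2\pi)$. * If $\mu$ is a positive integer, put $$W=\Bigl|\sqrt\zeta\,(V_1e^{j\phi_1}+V_2e^{j\phi_2})+Z_1\Bigr|^2+\sum_{i=2}^{\mu}\bigl|\sqrt\zeta\,U_ie^{j\varphi_i}+Z_i\bigr|^2,\qquad U_i\ge 0,\quad S=\sum_{i=2}^\mu U_i^2,$$ where $Z_i=X_i+jY_i$ with $X_i,Y_i\sim\mathcal N(0,\sigma^2)$, $\varphi_i\sim\mathcal U(0,2\pi)$, and $\zeta,\phi_1,\phi_2,\varphi_i,X_i,Y_i$ are all independent. * For real $\mu>0$, the model is generalized as follows: $\zeta,\phi_1,\phi_2$ are independent and, given them, $W$ has the $\kappa$-$\mu$ power density $$\frac1{2\sigma^2}\Bigl(\frac wd\Bigr)^{\frac{\mu-1}2}e^{-\frac{w+d}{2\sigma^2}}I_{\mu-1}\Bigl(\frac{\sqrt{dw}}{\sigma^2}\Bigr),\quad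 w>0,\qquad d=\zeta\bigl(|V_1e^{j\phi_1}+V_2e^{j\phi_2}|^2+S\bigr)$$ (for $d=0$, its limit as $d\to0^+$), where $I_\nu$ is the modified Bessel function of the first kind. Let $\gamma=(E_s/N_0)W$ be the SNR, $\overline\gamma=\mathbb E\{\gamma\}$, $K=\dfrac{V_1^2+V_2^2+S}{2\sigma^2\mu}$, $\Delta=\dfrac{2V_1V_2}{V_1^2+V_2^2+S}$, and let $\alpha=\phi_2-\phi_1$ modulo $2\pi$, taken in $[0,2\pi)$. The **$\kappa$-$\mu$ shadowed distribution** with parameters $\kappa\ge0$, $\mu,m>0$ and mean $g>0$ is the distribution of a variable which, given a variable $z$ distributed as $\zeta$ above, has the displayed $\kappa$-$\mu$ density with $2\sigma^2$ replaced by $p=\frac{g}{\mu(1+\kappa)}$ and $d$ replaced by $z\mu\kappa p$. **Lemma.** For all real $m>0$ and $\mu>0$, the PDF and the CDF of $\gamma$ are, for $x>0$ and for $x\ge 0$ respectively, $$f_\gamma(x)=\frac1\pi\int_0^\pi f_{\gamma|\theta}(x)\,d\theta,\qquad F_\gamma(x)=\frac1\pi\int_0^\pi F_{\gamma|\theta}(x)\,d\theta,$$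 and both vanish for $x<0$, where the integrands are integrable on $[0,\pi]$ and $$f_{\gamma|\theta}(x)=\frac{\mu^\mu m^m(1+K)^\mu}{\Gamma(\mu)\,\overline\gamma\,(\mu K(1+\Delta\cos\theta)+m)^m}\Bigl(\frac x{\overline\gamma}\Bigr)^{\mu-1}e^{-\frac{\mu(1+K)}{\overline\gamma}x}\;{}_1F_1\Bigl(m;\mu;\frac{\mu^2K(1+\Delta\cos\theta)(1+K)}{\mu K(1+\Delta\cos\theta)+m}\,\frac x{\overline\gamma}\Bigr),$$ $$F_{\gamma|\theta}(x)=\frac{\mu^{\mu-1}m^m(1+K)^\mu}{\Gamma(\mu)\,(\mu K(1+\Delta\cos\theta)+m)^m}\Bigl(\frac x{\overline\gamma}\Bigr)^{\mu}\,\Phi_2\Bigl(\mu-m,m;\mu+1;-\frac{\mu(1+K)x}{\overline\gamma},-\frac{\mu(1+K)}{\overline\gamma}\,\frac{mx}{\mu K(1+\Delta\cos\theta)+m}\Bigr).$$ Here ${}_1F_1(a;b;x)=\sum_n\frac{(a)_n}{(b)_n}\frac{x^n}{n!}$ and $\Phi_2(b,b';c;x,y)=\sum_{i,j}\frac{(b)_i(b')_j}{(c)_{i+j}}\frac{x^iy^j}{i!\,j!}$,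 with $(a)_n$ the Pochhammer symbol. Moreover $\alpha$ is uniform on $[0,2\pi)$ and, given $\alpha=\theta$, $\gamma$ has conditional PDF $f_{\gamma|\theta}$. For every $\theta$, $f_{\gamma|\theta}$ and $F_{\gamma|\theta}$ are the PDF and the CDF of the $\kappa$-$\mu$ shadowed distribution with parameters $\kappa_\theta=K(1+\Delta\cos\theta)$, $\mu$, $m$ and mean $\overline\gamma_\theta=\overline\gamma\,(1+\kappa_\theta)/(1+K)$. -/

import Mathlib

open MeasureTheory ProbabilityTheory

namespace MFTR

noncomputable section

/-- Kummer's confluent hypergeometric function `₁F₁(a; b; x)`, the series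
`∑ₙ (a)ₙ / (b)ₙ * xⁿ / n!` (an entire function when `b > 0`). -/
def hyp1F1 (a b x : ℝ) : ℝ :=
  ∑' n : ℕ, (ascPochhammer ℝ n).eval a / (ascPochhammer ℝ n).eval b * x ^ n / (n.factorial : ℝ)

/-- The bivariate confluent hypergeometric (Humbert) function `Φ₂(b, b'; c; x, y)`, the double
series `∑ᵢⱼ (b)ᵢ (b')ⱼ / (c)ᵢ₊ⱼ * xⁱ yʲ / (i! j!)` (entire in `x, y` when `c > 0`). -/
def humbertPhi2 (b b' c x y : ℝ) : ℝ :=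
  ∑' p : ℕ × ℕ, (ascPochhammer ℝ p.1).eval b * (ascPochhammer ℝ p.2).eval b' /
    (ascPochhammer ℝ (p.1 + p.2)).eval c *
    (x ^ p.1 * y ^ p.2) / ((p.1.factorial : ℝ) * (p.2.factorial : ℝ))

/-- The uniform distribution on `(0, 2π)`. -/
def uniformPhase : Measure ℝ := ProbabilityTheory.cond volume (Set.Ioo 0 (2 * Real.pi))

/-- The κ-μ power density at `w > 0`, for a real number `μ > 0` of clusters, diffuse power `p`
per cluster (`p = 2σ²`) and total dominant power `d ≥ 0`. For `d > 0` it equals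
`(1/p) (w/d)^((μ-1)/2) exp(-(w+d)/p) I_{μ-1}(2√(d w)/p)`, with the series of the modified Bessel
function `I_{μ-1}` written out; in this form it also covers `d = 0` (a Gamma density). -/
def kappaMuPDF (μ p d w : ℝ) : ℝ :=
  (1 / p) ^ μ * w ^ (μ - 1) * Real.exp (-(w + d) / p) *
    ∑' k : ℕ, (d * w / p ^ 2) ^ k / ((k.factorial : ℝ) * Real.Gamma (μ + k))

/-- The κ-μ shadowed distribution with parameters `κ, μ, m` and mean `g`: the κ-μ distribution
with diffuse power `p = g / (μ (1 + κ))` per cluster whose dominant power `μ κ p` is multiplied by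
an independent unit-mean Gamma variable with shape parameter `m`. -/
def kappaMuShadowed (κ μ m g : ℝ) : Measure ℝ :=
  (volume.restrict (Set.Ioi 0)).withDensity fun w =>
    ∫⁻ z, ENNReal.ofReal
      (kappaMuPDF μ (g / (μ * (1 + κ))) (z * (μ * κ * (g / (μ * (1 + κ))))) w) ∂(gammaMeasure m m)

variable {Ω : Type*} [MeasurableSpace Ω]

/-- The physical signal model with `k + 1` clusters. The shadowing `ζ`, the phases
`φ₁, φ₂, φ i` and the diffuse components `X i, Y i` are jointly independent with the indicated
laws, and `W` is the squared amplitude of the received signal. -/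
structure ClusterModel (P : Measure Ω) (k : ℕ) (V₁ V₂ : ℝ) (U : Fin k → ℝ) (σ m : ℝ)
    (ζ φ₁ φ₂ : Ω → ℝ) (φ : Fin k → Ω → ℝ) (X Y : Fin (k + 1) → Ω → ℝ) (W : Ω → ℝ) : Prop where
  law : HasLaw (fun ω => (ζ ω, φ₁ ω, φ₂ ω, (fun i => φ i ω), (fun i => X i ω), (fun i => Y i ω)))
    ((gammaMeasure m m).prod (uniformPhase.prod (uniformPhase.prod
      ((Measure.pi fun _ : Fin k => uniformPhase).prod
        ((Measure.pi fun _ : Fin (k + 1) => gaussianReal 0 (Real.toNNReal (σ ^ 2))).prod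
          (Measure.pi fun _ : Fin (k + 1) => gaussianReal 0 (Real.toNNReal (σ ^ 2)))))))) P
  power_eq : ∀ ω, W ω =
    ‖(Real.sqrt (ζ ω) : ℂ) * (V₁ * Complex.exp (Complex.I * φ₁ ω)
        + V₂ * Complex.exp (Complex.I * φ₂ ω)) + (X 0 ω + Complex.I * Y 0 ω)‖ ^ 2
    + ∑ i : Fin k, ‖(Real.sqrt (ζ ω) : ℂ) * (U i * Complex.exp (Complex.I * φ i ω))
        + (X i.succ ω + Complex.I * Y i.succ ω)‖ ^ 2

/-- The generalization of the signal model to a real number `μ > 0` of clusters. The shadowing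
`ζ` and the phases `φ₁, φ₂` are independent with the same laws as before and, given them, the
power `W` has the κ-μ density with diffuse power `2σ²` per cluster and dominant power
`ζ (|V₁ exp(jφ₁) + V₂ exp(jφ₂)|² + S)`, where `S` is the total specular power of the clusters
other than the first. -/
structure GeneralizedModel (P : Measure Ω) (μ V₁ V₂ S σ m : ℝ)
    (ζ φ₁ φ₂ : Ω → ℝ) (W : Ω → ℝ) : Prop where
  law : HasLaw (fun ω => (ζ ω, φ₁ ω, φ₂ ω, W ω))
    (((gammaMeasure m m).prod (uniformPhase.prod (uniformPhase.prod
      (volume.restrict (Set.Ioi 0))))).withDensity fun q : ℝ × ℝ × ℝ × ℝ =>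
        ENNReal.ofReal (kappaMuPDF μ (2 * σ ^ 2)
          (q.1 * (‖(V₁ : ℂ) * Complex.exp (Complex.I * q.2.1)
            + V₂ * Complex.exp (Complex.I * q.2.2.1)‖ ^ 2 + S)) q.2.2.2)) P

/-- `γ` is the SNR of an MFTR fading channel with shape parameters `K, m, μ, Δ` and mean `gbar`,
and `α` is the phase difference modulo `2π` of the two specular components of the first cluster. -/
def IsMFTR (P : Measure Ω) (γ α : Ω → ℝ) (K m μ Δ gbar : ℝ) : Prop :=
  ∃ (V₁ V₂ S σ Es N₀ : ℝ) (ζ φ₁ φ₂ W : Ω → ℝ),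
    0 < m ∧ 0 < μ ∧ 0 ≤ V₁ ∧ 0 ≤ V₂ ∧ 0 ≤ S ∧ 0 < V₁ ^ 2 + V₂ ^ 2 + S ∧
    0 < σ ∧ 0 < Es ∧ 0 < N₀ ∧
    K = (V₁ ^ 2 + V₂ ^ 2 + S) / (2 * σ ^ 2 * μ) ∧
    Δ = 2 * V₁ * V₂ / (V₁ ^ 2 + V₂ ^ 2 + S) ∧
    (∀ ω, γ ω = Es / N₀ * W ω) ∧
    (∀ ω, α ω = toIcoMod Real.two_pi_pos 0 (φ₂ ω - φ₁ ω)) ∧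
    gbar = ∫ ω, γ ω ∂P ∧
    ((∃ (k : ℕ) (U : Fin k → ℝ) (φ : Fin k → Ω → ℝ) (X Y : Fin (k + 1) → Ω → ℝ),
        μ = k + 1 ∧ (∀ i, 0 ≤ U i) ∧ S = ∑ i, U i ^ 2 ∧
        ClusterModel P k V₁ V₂ U σ m ζ φ₁ φ₂ φ X Y W) ∨
      GeneralizedModel P μ V₁ V₂ S σ m ζ φ₁ φ₂ W)

/-- `κ_θ = K (1 + Δ cos θ)`. -/
def kappa (K Δ θ : ℝ) : ℝ := K * (1 + Δ * Real.cos θ)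

/-- The explicit conditional density `f_{γ|θ}(x)`, for `x > 0`. -/
def condPDF (K m μ Δ gbar θ x : ℝ) : ℝ :=
  μ ^ μ * m ^ m * (1 + K) ^ μ /
      (Real.Gamma μ * gbar * (μ * K * (1 + Δ * Real.cos θ) + m) ^ m) *
    (x / gbar) ^ (μ - 1) * Real.exp (-(μ * (1 + K) / gbar) * x) *
    hyp1F1 m μ (μ ^ 2 * K * (1 + Δ * Real.cos θ) * (1 + K) /
      (μ * K * (1 + Δ * Real.cos θ) + m) * (x / gbar))

/-- The explicit conditional distribution function `F_{γ|θ}(x)`, for `x ≥ 0`. -/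
def condCDF (K m μ Δ gbar θ x : ℝ) : ℝ :=
  μ ^ (μ - 1) * m ^ m * (1 + K) ^ μ /
      (Real.Gamma μ * (μ * K * (1 + Δ * Real.cos θ) + m) ^ m) *
    (x / gbar) ^ μ *
    humbertPhi2 (μ - m) m (μ + 1) (-(μ * (1 + K) * x / gbar))
      (-(μ * (1 + K) / gbar) * (m * x / (μ * K * (1 + Δ * Real.cos θ) + m)))

end

end MFTR

/-! Given the shadowing and all the phases, `W` is the squared norm of a complex Gaussian vector.
Its moment generating function depends on the mean vector only through the total dominant power `d`,
and it equals that of the κ-μ law. Since such a function, finite on a half-line `t < c` with `c >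
0`, determines the law (`ext_of_mgf_eq_of_lt`), the physical model is the case `μ = k + 1` of the
generalized one (`ClusterModel.generalizedModel`).

In the generalized model, `d = ζ μ κ_θ (2σ²)` involves the phases only through `θ = φ₂ - φ₁` modulo
`2π`, and rotation invariance makes `θ` uniform. For fixed `θ`, averaging over `ζ` is by definition
the κ-μ shadowed mixture. The Gamma density integrates the Bessel series term by term, replacing `1
/ Γ(μ + k)` by a multiple of `(m)ₖ / (μ)ₖ`, which produces `₁F₁` (`lintegral_kappaMuPDF_gamma`). The
mean of `W` is `2σ² μ (1 + K)`, because the cosine averages to zero and `ζ` has mean one; this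
expresses the scale through `gbar`.

For the CDF, `exp (-a w) ₁F₁(m; μ; b w)` is expanded as `Φ₂(μ - m, m; μ; -a w, (b - a) w)` by
Chu–Vandermonde (`phi2Coeff_eq`). Integrating it against `w ^ (μ - 1)` raises the lower parameter to
`μ + 1`.

The probabilistic content is gathered in one identity for arbitrary test functions of `(α, γ)`,
`IsMFTR.lintegral_condPDF`. The joint law, the PDF and the CDF all follow from it by Tonelli; the
symmetry `θ ↦ 2π - θ` reduces the average to `[0, π]`. -/

namespace MFTR

/-! ### Pochhammer bounds and entire power series -/

lemma pochhammer_succ (a : ℝ) (n : ℕ) :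
    (ascPochhammer ℝ (n + 1)).eval a = (ascPochhammer ℝ n).eval a * (a + n) :=
  ascPochhammer_succ_eval n a

lemma pochhammer_pos {a : ℝ} (ha : 0 < a) (n : ℕ) : 0 < (ascPochhammer ℝ n).eval a :=
  ascPochhammer_pos n a ha

/-- Each factor obeys `|a + n| ≤ max |a| 1 * (n + 1)`. With the matching lower bound below, ratios
of Pochhammer symbols grow at most geometrically, so the remaining `1 / n!` forces convergence
everywhere. -/
lemma abs_pochhammer_le (a : ℝ) (n : ℕ) :
    |(ascPochhammer ℝ n).eval a| ≤ (max |a| 1) ^ n * n.factorial := by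
  induction n with
  | zero => simp
  | succ n ih =>
    rw [pochhammer_succ, abs_mul, pow_succ, Nat.factorial_succ]
    push_cast
    have h1 : |a + n| ≤ max |a| 1 * ((n : ℝ) + 1) := by
      have h2 : |a + (n : ℝ)| ≤ |a| + n := (abs_add_le _ _).trans (by simp)
      have h3 := le_max_left |a| 1
      have h4 := le_max_right |a| 1
      have h5 : (0 : ℝ) ≤ n := n.cast_nonneg
      nlinarith
    calc _ ≤ (max |a| 1 ^ n * n.factorial) * (max |a| 1 * ((n : ℝ) + 1)) := by gcongr
      _ = _ := by ring

lemma le_pochhammer {a : ℝ} (ha : 0 < a) (n : ℕ) :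
    (min a 1) ^ n * n.factorial ≤ (ascPochhammer ℝ n).eval a := by
  induction n with
  | zero => simp
  | succ n ih =>
    rw [pochhammer_succ, pow_succ, Nat.factorial_succ]
    push_cast
    have h1 : min a 1 * ((n : ℝ) + 1) ≤ a + n := by
      have h3 := min_le_left a 1
      have h4 := min_le_right a 1
      have h5 : (0 : ℝ) ≤ n := n.cast_nonneg
      nlinarith
    have h2 : 0 < min a 1 := lt_min ha one_pos
    calc _ = (min a 1 ^ n * n.factorial) * (min a 1 * ((n : ℝ) + 1)) := by ring
      _ ≤ _ := by gcongr; exact (pochhammer_pos ha n).le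

lemma inv_pochhammer_le {a : ℝ} (ha : 0 < a) (n : ℕ) :
    ((ascPochhammer ℝ n).eval a)⁻¹ ≤ ((min a 1)⁻¹) ^ n / n.factorial := by
  have h2 : 0 < min a 1 := lt_min ha one_pos
  rw [inv_pow, ← one_div, ← one_div, div_div]
  exact one_div_le_one_div_of_le (by positivity) (le_pochhammer ha n)

lemma Gamma_add_nat {a : ℝ} (ha : 0 < a) (n : ℕ) :
    Real.Gamma (a + n) = Real.Gamma a * (ascPochhammer ℝ n).eval a := by
  induction n with
  | zero => simp
  | succ n ih =>
    rw [pochhammer_succ]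
    push_cast
    rw [← add_assoc, Real.Gamma_add_one (by positivity), ih]
    ring

lemma summable_exp_series (x : ℝ) : Summable fun n : ℕ => x ^ n / (n.factorial : ℝ) :=
  Real.summable_pow_div_factorial x

/-- A power series whose coefficients decay like `Cⁿ / n!` converges everywhere. -/
lemma summable_of_coeff_le {c : ℕ → ℝ} {A C : ℝ} (hc : ∀ n, |c n| ≤ A * (C ^ n / n.factorial))
    (x : ℝ) : Summable fun n => c n * x ^ n := by
  refine Summable.of_norm_bounded ((summable_exp_series (C * |x|)).mul_left A) fun n => ?_
  rw [Real.norm_eq_abs, abs_mul, abs_pow, mul_pow]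
  calc _ ≤ A * (C ^ n / n.factorial) * |x| ^ n := by gcongr; exact hc n
    _ = _ := by ring

/-- A power series whose coefficients decay like `Cⁿ / n!` is continuous. -/
lemma continuous_of_coeff_le {c : ℕ → ℝ} {A C : ℝ} (hc : ∀ n, |c n| ≤ A * (C ^ n / n.factorial)) :
    Continuous fun x : ℝ => ∑' n, c n * x ^ n := by
  refine continuous_iff_continuousAt.2 fun x => ?_
  have hs := (summable_exp_series (C * (|x| + 1))).mul_left A
  refine (continuousOn_tsum (s := Set.Ioo (x - 1) (x + 1)) (fun n => by fun_prop) hs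
    fun n y hy => ?_).continuousAt (Ioo_mem_nhds (by linarith) (by linarith))
  have hy' : |y| ≤ |x| + 1 := by
    have : |y - x| ≤ 1 := abs_le.2 ⟨by linarith [hy.1], by linarith [hy.2]⟩
    calc |y| = |(y - x) + x| := by ring_nf
      _ ≤ |y - x| + |x| := abs_add_le _ _
      _ ≤ _ := by linarith
  rw [Real.norm_eq_abs, abs_mul, abs_pow, mul_pow]
  calc _ ≤ A * (C ^ n / n.factorial) * (|x| + 1) ^ n := by
        have := hc n
        have h0 := (abs_nonneg (c n)).trans this
        gcongr
    _ = _ := by ring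

lemma hyp1F1_coeff_le (a : ℝ) {b : ℝ} (hb : 0 < b) (n : ℕ) :
    |(ascPochhammer ℝ n).eval a / (ascPochhammer ℝ n).eval b / (n.factorial : ℝ)| ≤
      1 * ((max |a| 1 * (min b 1)⁻¹) ^ n / n.factorial) := by
  have h2 : 0 < min b 1 := lt_min hb one_pos
  rw [abs_div, abs_div, abs_of_pos (pochhammer_pos hb n), Nat.abs_cast, one_mul]
  gcongr
  rw [div_eq_mul_inv, mul_pow]
  calc _ ≤ (max |a| 1 ^ n * n.factorial) * (((min b 1)⁻¹) ^ n / n.factorial) := by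
        gcongr
        · exact inv_nonneg.2 (pochhammer_pos hb n).le
        · exact abs_pochhammer_le a n
        · exact inv_pochhammer_le hb n
    _ = _ := by field_simp

lemma hyp1F1_eq (a b x : ℝ) : hyp1F1 a b x =
    ∑' n : ℕ, (ascPochhammer ℝ n).eval a / (ascPochhammer ℝ n).eval b / (n.factorial : ℝ) * x ^ n := by
  unfold hyp1F1
  congr 1; ext n; ring

lemma continuous_hyp1F1 (a : ℝ) {b : ℝ} (hb : 0 < b) : Continuous (hyp1F1 a b) := by
  have := continuous_of_coeff_le (hyp1F1_coeff_le a hb)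
  convert this using 2 with x
  exact hyp1F1_eq a b x

lemma summable_hyp1F1 (a : ℝ) {b : ℝ} (hb : 0 < b) (x : ℝ) : Summable fun n : ℕ =>
    (ascPochhammer ℝ n).eval a / (ascPochhammer ℝ n).eval b / (n.factorial : ℝ) * x ^ n :=
  summable_of_coeff_le (hyp1F1_coeff_le a hb) x

lemma hyp1F1_nonneg {a b x : ℝ} (ha : 0 < a) (hb : 0 < b) (hx : 0 ≤ x) : 0 ≤ hyp1F1 a b x := by
  refine tsum_nonneg fun n => ?_
  have h1 := pochhammer_pos ha n
  have h2 := pochhammer_pos hb n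
  positivity

lemma bessel_coeff_le {μ : ℝ} (hμ : 0 < μ) (n : ℕ) :
    |1 / ((n.factorial : ℝ) * Real.Gamma (μ + n))| ≤
      (Real.Gamma μ)⁻¹ * ((min μ 1)⁻¹ ^ n / n.factorial) := by
  have h2 : 0 < min μ 1 := lt_min hμ one_pos
  have h3 := Real.Gamma_pos_of_pos hμ
  have h4 := pochhammer_pos hμ n
  rw [Gamma_add_nat hμ, abs_of_pos (by positivity)]
  have h5 : (1 : ℝ) ≤ n.factorial := by exact_mod_cast n.factorial_pos
  calc _ = (n.factorial : ℝ)⁻¹ * ((Real.Gamma μ)⁻¹ * ((ascPochhammer ℝ n).eval μ)⁻¹) := by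
        field_simp
    _ ≤ 1 * ((Real.Gamma μ)⁻¹ * ((min μ 1)⁻¹ ^ n / n.factorial)) := by
        gcongr
        · exact inv_le_one_of_one_le₀ h5
        · exact inv_pochhammer_le hμ n
    _ = _ := one_mul _

lemma summable_bessel {μ : ℝ} (hμ : 0 < μ) (x : ℝ) :
    Summable fun k : ℕ => x ^ k / ((k.factorial : ℝ) * Real.Gamma (μ + k)) := by
  convert summable_of_coeff_le (bessel_coeff_le hμ) x using 2 with k
  ring

lemma continuous_bessel {μ : ℝ} (hμ : 0 < μ) :
    Continuous fun x : ℝ => ∑' k : ℕ, x ^ k / ((k.factorial : ℝ) * Real.Gamma (μ + k)) := by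
  convert continuous_of_coeff_le (bessel_coeff_le hμ) using 4 with x k
  ring

lemma measurable_kappaMuPDF {μ p : ℝ} (hμ : 0 < μ) :
    Measurable fun q : ℝ × ℝ => kappaMuPDF μ p q.1 q.2 := by
  unfold kappaMuPDF
  refine Measurable.mul (by fun_prop) ?_
  exact (continuous_bessel hμ).measurable.comp (by fun_prop)

/-! ### Laplace transforms of the κ-μ density -/

/-- Termwise Laplace transform of `x ^ (a - 1)` times a power series with nonnegative
coefficients. -/
lemma lintegral_rpow_mul_series {a b C : ℝ} {c : ℕ → ℝ} (ha : 0 < a) (hb : 0 < b) (hC : 0 ≤ C)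
    (hc : ∀ k, 0 ≤ c k) (hs : ∀ x, 0 < x → Summable fun k => c k * x ^ k)
    (hS : Summable fun k => c k * (Real.Gamma (a + k) * (1 / b) ^ k)) :
    ∫⁻ x in Set.Ioi (0 : ℝ), ENNReal.ofReal
      (C * (x ^ (a - 1) * Real.exp (-(b * x))) * ∑' k, c k * x ^ k) =
    ENNReal.ofReal (C * (1 / b) ^ a * ∑' k, c k * (Real.Gamma (a + k) * (1 / b) ^ k)) := by
  have h1 : ∀ x ∈ Set.Ioi (0 : ℝ), ENNReal.ofReal
      (C * (x ^ (a - 1) * Real.exp (-(b * x))) * ∑' k, c k * x ^ k) =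
      ∑' k : ℕ, ENNReal.ofReal (C * c k * (x ^ (a + k - 1) * Real.exp (-(b * x)))) := by
    intro x hx
    rw [Set.mem_Ioi] at hx
    rw [← tsum_mul_left, ENNReal.ofReal_tsum_of_nonneg]
    · congr 1; ext k
      rw [show a + (k : ℝ) - 1 = (a - 1) + k by ring, Real.rpow_add_natCast hx.ne']
      congr 1; ring
    · intro k
      have := hc k
      positivity
    · exact (hs x hx).mul_left _
  rw [setLIntegral_congr_fun measurableSet_Ioi h1, lintegral_tsum (fun k => by fun_prop),
    ← tsum_mul_left, ENNReal.ofReal_tsum_of_nonneg _ (hS.mul_left _)]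
  · congr 1; ext k
    have hak : 0 < a + (k : ℝ) := by positivity
    have hI := Real.integral_rpow_mul_exp_neg_mul_Ioi hak hb
    have hG := Real.Gamma_pos_of_pos hak
    -- A non-integrable function would have integral zero, whereas the known value is positive.
    have hint : IntegrableOn (fun x : ℝ => x ^ (a + k - 1) * Real.exp (-(b * x))) (Set.Ioi 0) := by
      by_contra hcon
      rw [integral_undef hcon] at hI
      have : 0 < (1 / b) ^ (a + k) * Real.Gamma (a + k) := by positivity
      linarith
    rw [← ofReal_integral_eq_lintegral_ofReal (hint.const_mul _), integral_const_mul, hI,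
      Real.rpow_add_natCast (by positivity)]
    · congr 1; ring
    · refine (ae_restrict_iff' measurableSet_Ioi).2 (ae_of_all _ fun x hx => ?_)
      rw [Set.mem_Ioi] at hx
      have := hc k
      simp only [Pi.zero_apply]
      positivity
  · intro k
    have hak : 0 < a + (k : ℝ) := by positivity
    have hG := Real.Gamma_pos_of_pos hak
    have := hc k
    positivity

/-- The Laplace transform of the κ-μ density. -/
lemma lintegral_exp_mul_kappaMuPDF {μ p d t : ℝ} (hμ : 0 < μ) (hp : 0 < p) (hd : 0 ≤ d)
    (ht : t < 1 / p) :
    ∫⁻ w in Set.Ioi (0 : ℝ), ENNReal.ofReal (Real.exp (t * w) * kappaMuPDF μ p d w) =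
      ENNReal.ofReal ((1 / (1 - p * t)) ^ μ * Real.exp (d * t / (1 - p * t))) := by
  have hb : 0 < 1 / p - t := by linarith
  have hbp : 0 < 1 - p * t := by
    have := mul_pos hp hb
    rwa [mul_sub, mul_one_div_cancel hp.ne'] at this
  have hG : ∀ k : ℕ, 0 < Real.Gamma (μ + k) := fun k => Real.Gamma_pos_of_pos (by positivity)
  -- The Gamma factor from the integral cancels the one in the Bessel series, leaving an exponential
  -- series.
  have hexp : ∀ k : ℕ, (d / p ^ 2) ^ k / ((k.factorial : ℝ) * Real.Gamma (μ + k)) *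
      (Real.Gamma (μ + k) * (1 / (1 / p - t)) ^ k) = (d / (p * (1 - p * t))) ^ k / k.factorial := by
    intro k
    have := hG k
    have h3 : d / (p * (1 - p * t)) = d / p ^ 2 * (1 / (1 / p - t)) := by
      rw [show 1 / p - t = (1 - p * t) / p by field_simp]
      field_simp
    rw [h3, mul_pow]
    field_simp
  have key := lintegral_rpow_mul_series (a := μ) (b := 1 / p - t)
    (C := (1 / p) ^ μ * Real.exp (-d / p))
    (c := fun k => (d / p ^ 2) ^ k / ((k.factorial : ℝ) * Real.Gamma (μ + k))) hμ hb
    (by positivity) (fun k => by have := hG k; positivity)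
    (fun x _ => by
      convert summable_bessel hμ (d * x / p ^ 2) using 2 with k
      ring)
    (by simp_rw [hexp]; exact summable_exp_series _)
  simp_rw [hexp] at key
  have hsum : ∑' k : ℕ, (d / (p * (1 - p * t))) ^ k / (k.factorial : ℝ) =
      Real.exp (d / (p * (1 - p * t))) := by
    rw [Real.exp_eq_exp_ℝ, NormedSpace.exp_eq_tsum_div]
  rw [hsum] at key
  convert key using 1
  · refine setLIntegral_congr_fun measurableSet_Ioi fun w hw => ?_
    congr 1
    unfold kappaMuPDF
    have e1 : Real.exp (t * w) * Real.exp (-(w + d) / p) =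
        Real.exp (-d / p) * Real.exp (-((1 / p - t) * w)) := by
      rw [← Real.exp_add, ← Real.exp_add]
      congr 1
      field_simp
      ring
    have e2 : ∀ k : ℕ, (d * w / p ^ 2) ^ k / ((k.factorial : ℝ) * Real.Gamma (μ + k)) =
        (d / p ^ 2) ^ k / ((k.factorial : ℝ) * Real.Gamma (μ + k)) * w ^ k := fun k => by ring
    simp_rw [e2]
    linear_combination ((1 / p) ^ μ * w ^ (μ - 1) * ∑' k : ℕ, (d / p ^ 2) ^ k /
      ((k.factorial : ℝ) * Real.Gamma (μ + k)) * w ^ k) * e1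
  · congr 1
    have e3 : (1 / (1 - p * t)) ^ μ = (1 / p) ^ μ * (1 / (1 / p - t)) ^ μ := by
      rw [← Real.mul_rpow (by positivity) (by positivity)]
      congr 1
      rw [show 1 / p - t = (1 - p * t) / p by field_simp]
      field_simp
    have e4 : Real.exp (d * t / (1 - p * t)) =
        Real.exp (-d / p) * Real.exp (d / (p * (1 - p * t))) := by
      rw [← Real.exp_add]
      congr 1
      have := hbp.ne'
      rw [div_add_div _ _ hp.ne' (by positivity), div_eq_div_iff this (by positivity)]
      ring
    rw [e3, e4]
    ring

/-- The κ-μ shadowed density in terms of `₁F₁`: `s = D / p` is the ratio of the mean dominant power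
to the diffuse power per cluster. -/
lemma lintegral_kappaMuPDF_gamma {μ p D m w : ℝ} (hμ : 0 < μ) (hp : 0 < p) (hD : 0 ≤ D)
    (hm : 0 < m) (hw : 0 < w) :
    ∫⁻ z, ENNReal.ofReal (kappaMuPDF μ p (z * D) w) ∂(gammaMeasure m m) =
      ENNReal.ofReal ((1 / p) ^ μ * w ^ (μ - 1) * Real.exp (-(w / p)) / Real.Gamma μ *
        (m / (D / p + m)) ^ m * hyp1F1 m μ (D / p / (D / p + m) * (w / p))) := by
  have hs : 0 ≤ D / p := by positivity
  have hGm := Real.Gamma_pos_of_pos hm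
  have hGμ := Real.Gamma_pos_of_pos hμ
  have hG : ∀ k : ℕ, 0 < Real.Gamma (μ + k) := fun k => Real.Gamma_pos_of_pos (by positivity)
  -- Here the Gamma factors have different bases `m` and `μ`; their quotient is the source of `(m)ₖ
  -- / (μ)ₖ`.
  have hterm : ∀ k : ℕ, (D * w / p ^ 2) ^ k / ((k.factorial : ℝ) * Real.Gamma (μ + k)) *
      (Real.Gamma (m + k) * (1 / (D / p + m)) ^ k) = Real.Gamma m / Real.Gamma μ *
      ((ascPochhammer ℝ k).eval m / (ascPochhammer ℝ k).eval μ / (k.factorial : ℝ) *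
        (D / p / (D / p + m) * (w / p)) ^ k) := by
    intro k
    have h1 := pochhammer_pos hμ k
    rw [Gamma_add_nat hμ, Gamma_add_nat hm]
    have h3 : D / p / (D / p + m) * (w / p) = (D * w / p ^ 2) * (1 / (D / p + m)) := by
      field_simp
    rw [h3, mul_pow]
    field_simp
  have key := lintegral_rpow_mul_series (a := m) (b := D / p + m)
    (C := m ^ m / Real.Gamma m * ((1 / p) ^ μ * w ^ (μ - 1) * Real.exp (-(w / p))))
    (c := fun k => (D * w / p ^ 2) ^ k / ((k.factorial : ℝ) * Real.Gamma (μ + k))) hm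
    (by positivity) (by positivity) (fun k => by have := hG k; positivity)
    (fun x _ => by
      convert summable_bessel hμ (x * D * w / p ^ 2) using 2 with k
      ring)
    (by simp_rw [hterm]; exact (summable_hyp1F1 m hμ _).mul_left _)
  simp_rw [hterm] at key
  rw [tsum_mul_left, ← hyp1F1_eq] at key
  rw [gammaMeasure, lintegral_withDensity_eq_lintegral_mul₀]
  rotate_left
  · exact (measurable_gammaPDFReal m m).ennreal_ofReal.aemeasurable
  · exact (((measurable_kappaMuPDF hμ).comp (by fun_prop :
      Measurable fun z : ℝ => (z * D, w))).ennreal_ofReal).aemeasurable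
  have h0 : ∀ x : ℝ, x ∉ Set.Ici 0 →
      (gammaPDF m m * fun z => ENNReal.ofReal (kappaMuPDF μ p (z * D) w)) x = 0 := by
    intro x hx
    simp only [Pi.mul_apply]
    rw [gammaPDF_of_neg (by simpa using hx), zero_mul]
  rw [← setLIntegral_eq_of_support_subset (s := Set.Ici 0)
    (fun x hx => by by_contra h; exact hx (h0 x h)),
    setLIntegral_congr Ioi_ae_eq_Ici.symm]
  convert key using 1
  · refine setLIntegral_congr_fun measurableSet_Ioi fun z hz => ?_
    rw [Set.mem_Ioi] at hz
    simp only [Pi.mul_apply]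
    rw [gammaPDF_of_nonneg hz.le, ← ENNReal.ofReal_mul (by positivity)]
    congr 1
    unfold kappaMuPDF
    have e1 : Real.exp (-(m * z)) * Real.exp (-(w + z * D) / p) =
        Real.exp (-(w / p)) * Real.exp (-((D / p + m) * z)) := by
      rw [← Real.exp_add, ← Real.exp_add]
      congr 1
      field_simp
      ring
    have e2 : ∀ k : ℕ, (z * D * w / p ^ 2) ^ k / ((k.factorial : ℝ) * Real.Gamma (μ + k)) =
        (D * w / p ^ 2) ^ k / ((k.factorial : ℝ) * Real.Gamma (μ + k)) * z ^ k := fun k => by ring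
    simp_rw [e2]
    linear_combination (m ^ m / Real.Gamma m * z ^ (m - 1) * (1 / p) ^ μ * w ^ (μ - 1) *
      ∑' k : ℕ, (D * w / p ^ 2) ^ k / ((k.factorial : ℝ) * Real.Gamma (μ + k)) * z ^ k) * e1
  · congr 1
    rw [Real.div_rpow hm.le (by positivity), Real.div_rpow zero_le_one (by positivity : 0 ≤ D / p + m),
      Real.one_rpow]
    generalize hyp1F1 m μ _ = H
    generalize (D / p + m) ^ m = T
    field_simp

/-! ### The function `Φ₂` and the integral of the shadowed density -/

open Finset in
/-- The Chu–Vandermonde identity for rising factorials. -/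
lemma sum_pochhammer_mul_pochhammer (a b : ℝ) (n : ℕ) :
    ∑ q ∈ Finset.HasAntidiagonal.antidiagonal n, (ascPochhammer ℝ q.1).eval a / (q.1.factorial : ℝ) *
      ((ascPochhammer ℝ q.2).eval b / (q.2.factorial : ℝ)) =
    (ascPochhammer ℝ n).eval (a + b) / (n.factorial : ℝ) := by
  have hrec : ∀ (c : ℝ) (k : ℕ), ((k : ℝ) + 1) * ((ascPochhammer ℝ (k + 1)).eval c /
      ((k + 1).factorial : ℝ)) = (c + k) * ((ascPochhammer ℝ k).eval c / (k.factorial : ℝ)) := by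
    intro c k
    rw [pochhammer_succ, Nat.factorial_succ]
    push_cast
    field_simp
  induction n with
  | zero => simp
  | succ n ih =>
    have hn : ((n : ℝ) + 1) ≠ 0 := by positivity
    apply mul_left_cancel₀ hn
    rw [hrec, ← ih, mul_sum, mul_sum]
    set A : ℕ → ℝ := fun k => (ascPochhammer ℝ k).eval a / (k.factorial : ℝ) with hA
    set B : ℕ → ℝ := fun k => (ascPochhammer ℝ k).eval b / (k.factorial : ℝ) with hB
    -- Writing `n + 1` as the sum of the two indices splits the sum in two; lowering one index in
    -- each half by `hrec` yields the factor `(a + i) + (b + j) = a + b + n`.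
    have h1 : ∑ q ∈ Finset.HasAntidiagonal.antidiagonal (n + 1), ((n : ℝ) + 1) * (A q.1 * B q.2) =
        ∑ q ∈ Finset.HasAntidiagonal.antidiagonal (n + 1), (q.1 : ℝ) * A q.1 * B q.2 +
          ∑ q ∈ Finset.HasAntidiagonal.antidiagonal (n + 1), A q.1 * ((q.2 : ℝ) * B q.2) := by
      rw [← sum_add_distrib]
      refine sum_congr rfl fun q hq => ?_
      have : (q.1 : ℝ) + q.2 = n + 1 := by exact_mod_cast Finset.HasAntidiagonal.mem_antidiagonal.1 hq
      rw [← this]; ring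
    change ∑ q ∈ Finset.HasAntidiagonal.antidiagonal (n + 1), ((n : ℝ) + 1) * (A q.1 * B q.2) =
      ∑ q ∈ Finset.HasAntidiagonal.antidiagonal n, (a + b + n) * (A q.1 * B q.2)
    rw [h1, Finset.Nat.sum_antidiagonal_succ, Finset.Nat.sum_antidiagonal_succ']
    simp only [Nat.cast_zero, zero_mul, mul_zero, zero_add, Nat.cast_add, Nat.cast_one]
    rw [← sum_add_distrib]
    refine sum_congr rfl fun q hq => ?_
    have : (q.1 : ℝ) + q.2 = n := by exact_mod_cast Finset.HasAntidiagonal.mem_antidiagonal.1 hq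
    have e1 := hrec a q.1
    have e2 := hrec b q.2
    change _ = (a + q.1) * A q.1 at e1
    change _ = (b + q.2) * B q.2 at e2
    rw [← this]
    linear_combination B q.2 * e1 + A q.1 * e2

lemma pochhammer_add (a : ℝ) (k l : ℕ) : (ascPochhammer ℝ (k + l)).eval a =
    (ascPochhammer ℝ k).eval a * (ascPochhammer ℝ l).eval (a + k) := by
  rw [← ascPochhammer_mul]
  simp

-- The regrouping `i + (k + l) = (i + l) + k` collects the two indices that carry powers of `-a` in
-- `phi2Coeff_eq`, so that Chu–Vandermonde applies to the inner sum.
open Finset in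
lemma sum_antidiagonal_assoc (f : ℕ → ℕ → ℕ → ℝ) (n : ℕ) :
    ∑ q ∈ Finset.HasAntidiagonal.antidiagonal n, ∑ r ∈ Finset.HasAntidiagonal.antidiagonal q.2, f q.1 r.1 r.2 =
      ∑ q ∈ Finset.HasAntidiagonal.antidiagonal n, ∑ r ∈ Finset.HasAntidiagonal.antidiagonal q.1, f r.1 q.2 r.2 := by
  rw [sum_sigma', sum_sigma']
  refine sum_nbij' (fun x => ⟨(x.1.1 + x.2.2, x.2.1), (x.1.1, x.2.2)⟩)
    (fun x => ⟨(x.2.1, x.1.2 + x.2.2), (x.1.2, x.2.2)⟩) ?_ ?_ ?_ ?_ ?_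
  · rintro ⟨⟨i, j⟩, ⟨k, l⟩⟩ h
    simp only [mem_sigma, Finset.HasAntidiagonal.mem_antidiagonal] at h ⊢
    exact ⟨by lia, by lia⟩
  · rintro ⟨⟨i, j⟩, ⟨k, l⟩⟩ h
    simp only [mem_sigma, Finset.HasAntidiagonal.mem_antidiagonal] at h ⊢
    exact ⟨by lia, by lia⟩
  · rintro ⟨⟨i, j⟩, ⟨k, l⟩⟩ h
    simp only [mem_sigma, Finset.HasAntidiagonal.mem_antidiagonal] at h
    obtain ⟨h1, h2⟩ := h
    subst h2
    rfl
  · rintro ⟨⟨i, j⟩, ⟨k, l⟩⟩ h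
    simp only [mem_sigma, Finset.HasAntidiagonal.mem_antidiagonal] at h
    obtain ⟨h1, h2⟩ := h
    subst h2
    rfl
  · rintro ⟨⟨i, j⟩, ⟨k, l⟩⟩ h
    rfl

/-- The homogeneous part of degree `n` of the numerator of the series `Φ₂(b, b'; c; x, y)`. -/
noncomputable def phi2Coeff (b b' x y : ℝ) (n : ℕ) : ℝ :=
  ∑ q ∈ Finset.HasAntidiagonal.antidiagonal n, (ascPochhammer ℝ q.1).eval b / (q.1.factorial : ℝ) * x ^ q.1 *
    ((ascPochhammer ℝ q.2).eval b' / (q.2.factorial : ℝ) * y ^ q.2)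

open Finset in
/-- Coefficientwise form of `exp (-a w) ₁F₁(m; μ; b w) = Φ₂(μ - m, m; μ; -a w, (b - a) w)`. -/
lemma phi2Coeff_eq {μ : ℝ} (hμ : 0 < μ) (m a b : ℝ) (n : ℕ) :
    phi2Coeff (μ - m) m (-a) (b - a) n = (ascPochhammer ℝ n).eval μ *
      ∑ q ∈ Finset.HasAntidiagonal.antidiagonal n, (-a) ^ q.1 / (q.1.factorial : ℝ) *
        ((ascPochhammer ℝ q.2).eval m / (ascPochhammer ℝ q.2).eval μ / (q.2.factorial : ℝ) *
          b ^ q.2) := by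
  unfold phi2Coeff
  -- Binomial expansion of `(b - a) ^ j`, with `(m)ₖ₊ₗ = (m)ₖ (m + k)ₗ`.
  have hexp : ∀ j : ℕ, (ascPochhammer ℝ j).eval m / (j.factorial : ℝ) * (b - a) ^ j =
      ∑ r ∈ Finset.HasAntidiagonal.antidiagonal j, (ascPochhammer ℝ r.1).eval m / (r.1.factorial : ℝ) * b ^ r.1 *
        ((ascPochhammer ℝ r.2).eval (m + r.1) / (r.2.factorial : ℝ) * (-a) ^ r.2) := by
    intro j
    rw [sub_eq_add_neg, (Commute.all b (-a)).add_pow', mul_sum]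
    refine sum_congr rfl fun r hr => ?_
    have hr' := Finset.HasAntidiagonal.mem_antidiagonal.1 hr
    subst hr'
    rw [pochhammer_add, nsmul_eq_mul, Nat.cast_add_choose]
    field_simp
  simp_rw [hexp, mul_sum]
  rw [sum_antidiagonal_assoc (fun i k l => (ascPochhammer ℝ i).eval (μ - m) / (i.factorial : ℝ) *
    (-a) ^ i * ((ascPochhammer ℝ k).eval m / (k.factorial : ℝ) * b ^ k *
        ((ascPochhammer ℝ l).eval (m + k) / (l.factorial : ℝ) * (-a) ^ l)))]
  refine sum_congr rfl fun q hq => ?_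
  have hq' := Finset.HasAntidiagonal.mem_antidiagonal.1 hq
  have hpos := pochhammer_pos hμ q.2
  have e1 : (ascPochhammer ℝ n).eval μ =
      (ascPochhammer ℝ q.2).eval μ * (ascPochhammer ℝ q.1).eval (μ + q.2) := by
    rw [← pochhammer_add, add_comm, hq']
  -- The parameters add up to `μ + q.2`, so `m` drops out, leaving the factor of `(μ)ₙ`
  -- complementary to `(μ)` at `q.2`.
  have e2 := sum_pochhammer_mul_pochhammer (μ - m) (m + q.2) q.1
  rw [show μ - m + (m + (q.2 : ℝ)) = μ + q.2 by ring] at e2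
  calc _ = (∑ r ∈ Finset.HasAntidiagonal.antidiagonal q.1, (ascPochhammer ℝ r.1).eval (μ - m) / (r.1.factorial : ℝ) *
        ((ascPochhammer ℝ r.2).eval (m + q.2) / (r.2.factorial : ℝ))) * ((-a) ^ q.1 *
        ((ascPochhammer ℝ q.2).eval m / (q.2.factorial : ℝ) * b ^ q.2)) := by
        rw [sum_mul]
        refine sum_congr rfl fun r hr => ?_
        rw [← Finset.HasAntidiagonal.mem_antidiagonal.1 hr, pow_add]
        ring
    _ = _ := by
        rw [e2, e1]
        field_simp

/-- Since `i! j! ≤ (i + j)!`, the denominator compensates the factorial growth of both numerators,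
and a product of two exponential series dominates. Absolute convergence is what permits summation by
total degree. -/
lemma summable_humbertPhi2 (b b' : ℝ) {c : ℝ} (hc : 0 < c) (x y : ℝ) :
    Summable fun p : ℕ × ℕ => (ascPochhammer ℝ p.1).eval b * (ascPochhammer ℝ p.2).eval b' /
    (ascPochhammer ℝ (p.1 + p.2)).eval c *
    (x ^ p.1 * y ^ p.2) / ((p.1.factorial : ℝ) * (p.2.factorial : ℝ)) := by
  set M := max |b| 1
  set M' := max |b'| 1
  set e := (min c 1)⁻¹ with he
  have h2 : 0 < min c 1 := lt_min hc one_pos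
  have he0 : 0 < e := inv_pos.2 h2
  have hs := (summable_exp_series (M * e * |x|)).mul_of_nonneg (summable_exp_series (M' * e * |y|))
    (fun n => by simp only [Pi.zero_apply]; positivity)
    (fun n => by simp only [Pi.zero_apply]; positivity)
  refine Summable.of_norm_bounded hs fun p => ?_
  obtain ⟨i, j⟩ := p
  simp only
  have hfac : ((i.factorial : ℝ) * j.factorial) ≤ ((i + j).factorial : ℝ) := by
    exact_mod_cast Nat.le_of_dvd (Nat.factorial_pos _) (Nat.factorial_mul_factorial_dvd_factorial_add i j)
  have hinv : ((ascPochhammer ℝ (i + j)).eval c)⁻¹ ≤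
      e ^ (i + j) / ((i.factorial : ℝ) * j.factorial) :=
    (inv_pochhammer_le hc (i + j)).trans (by gcongr)
  have hpc := pochhammer_pos hc (i + j)
  rw [Real.norm_eq_abs, abs_div, abs_mul, abs_div, abs_mul, abs_mul, abs_mul, Nat.abs_cast,
    Nat.abs_cast, abs_of_pos hpc, abs_pow, abs_pow, div_eq_mul_inv (_ * _) (Polynomial.eval _ _)]
  calc _ ≤ ((M ^ i * i.factorial) * (M' ^ j * j.factorial) *
        (e ^ (i + j) / ((i.factorial : ℝ) * j.factorial))) * (|x| ^ i * |y| ^ j) /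
        ((i.factorial : ℝ) * j.factorial) := by
        gcongr
        · exact abs_pochhammer_le b i
        · exact abs_pochhammer_le b' j
    _ = _ := by
        rw [mul_pow, mul_pow, mul_pow, mul_pow, pow_add]
        field_simp

/-- The series of `Φ₂` summed by total degree. -/
lemma humbertPhi2_eq_tsum (b b' : ℝ) {c : ℝ} (hc : 0 < c) (x y X : ℝ) :
    humbertPhi2 b b' c (x * X) (y * X) =
      ∑' n : ℕ, phi2Coeff b b' x y n / (ascPochhammer ℝ n).eval c * X ^ n := by
  have hs := summable_humbertPhi2 b b' hc (x * X) (y * X)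
  unfold humbertPhi2
  rw [← Finset.HasAntidiagonal.sigmaAntidiagonalEquivProd.tsum_eq]
  refine (Summable.tsum_sigma (Finset.HasAntidiagonal.sigmaAntidiagonalEquivProd.summable_iff.2 hs)).trans ?_
  congr 1; ext n
  rw [tsum_fintype, phi2Coeff, Finset.sum_div, Finset.sum_mul, ← Finset.sum_coe_sort (Finset.HasAntidiagonal.antidiagonal n)]
  refine Finset.sum_congr rfl fun q _ => ?_
  obtain ⟨⟨i, j⟩, hq⟩ := q
  have hq' := Finset.HasAntidiagonal.mem_antidiagonal.1 hq
  simp only at hq'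
  subst hq'
  simp only [Function.comp_apply, Finset.HasAntidiagonal.sigmaAntidiagonalEquivProd_apply]
  rw [mul_pow, mul_pow, pow_add]
  field_simp

lemma summable_norm_phi2Coeff {μ : ℝ} (hμ : 0 < μ) (m a b X : ℝ) : Summable fun n : ℕ =>
    ‖phi2Coeff (μ - m) m (-a) (b - a) n / (ascPochhammer ℝ n).eval μ * X ^ n‖ := by
  have h := summable_norm_sum_mul_antidiagonal_of_summable_norm
    (summable_exp_series (-a * X)).norm (summable_hyp1F1 m hμ (b * X)).norm
  refine h.congr fun n => ?_
  congr 1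
  rw [phi2Coeff_eq hμ, mul_div_cancel_left₀ _ (pochhammer_pos hμ n).ne', Finset.sum_mul]
  refine Finset.sum_congr rfl fun q hq => ?_
  rw [← Finset.HasAntidiagonal.mem_antidiagonal.1 hq, mul_pow, mul_pow, pow_add]
  ring

/-- The Cauchy product of the two series has exactly the coefficients computed in `phi2Coeff_eq`. -/
lemma exp_mul_hyp1F1_eq {μ : ℝ} (hμ : 0 < μ) (m a b X : ℝ) :
    Real.exp (-(a * X)) * hyp1F1 m μ (b * X) =
    ∑' n : ℕ, phi2Coeff (μ - m) m (-a) (b - a) n / (ascPochhammer ℝ n).eval μ * X ^ n := by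
  rw [← neg_mul, Real.exp_eq_exp_ℝ, NormedSpace.exp_eq_tsum_div, hyp1F1_eq,
    tsum_mul_tsum_eq_tsum_sum_antidiagonal_of_summable_norm
    (summable_exp_series (-a * X)).norm (summable_hyp1F1 m hμ (b * X)).norm]
  congr 1; ext n
  rw [phi2Coeff_eq hμ, mul_div_cancel_left₀ _ (pochhammer_pos hμ n).ne', Finset.sum_mul]
  refine Finset.sum_congr rfl fun q hq => ?_
  rw [← Finset.HasAntidiagonal.mem_antidiagonal.1 hq, mul_pow, mul_pow, pow_add]
  ring

lemma integrableOn_rpow_mul_exp_mul_hyp1F1 {μ : ℝ} (hμ : 0 < μ) (m a b : ℝ) (X : ℝ) :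
    IntervalIntegrable (fun w : ℝ => w ^ (μ - 1) * (Real.exp (-(a * w)) * hyp1F1 m μ (b * w)))
      volume 0 X := by
  refine (intervalIntegral.intervalIntegrable_rpow' (by linarith)).mul_continuousOn ?_
  have := continuous_hyp1F1 m hμ
  fun_prop

/-- The distribution function of the κ-μ shadowed law, up to normalization. -/
lemma integral_rpow_mul_exp_mul_hyp1F1 {μ : ℝ} (hμ : 0 < μ) (m a b : ℝ) {X : ℝ} (hX : 0 ≤ X) :
    ∫ w in (0 : ℝ)..X, w ^ (μ - 1) * (Real.exp (-(a * w)) * hyp1F1 m μ (b * w)) =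
      X ^ μ / μ * humbertPhi2 (μ - m) m (μ + 1) (-a * X) ((b - a) * X) := by
  set g : ℕ → ℝ := fun n => phi2Coeff (μ - m) m (-a) (b - a) n / (ascPochhammer ℝ n).eval μ with hg
  have hterm : ∀ (n : ℕ), ∫ w in (0 : ℝ)..X, w ^ (μ + n - 1) = X ^ μ * X ^ n / (μ + n) := by
    intro n
    have hn : 0 < μ + n := by positivity
    rw [integral_rpow (Or.inl (by linarith)), sub_add_cancel, Real.zero_rpow hn.ne', sub_zero,
      Real.rpow_add_natCast' hX hn.ne']
  have hint : ∀ n : ℕ, IntervalIntegrable (fun w : ℝ => w ^ (μ + n - 1)) volume 0 X := fun n =>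
    intervalIntegral.intervalIntegrable_rpow' (by have : (0 : ℝ) ≤ n := n.cast_nonneg; linarith)
  have key := hasSum_integral_of_summable_integral_norm (μ := volume.restrict (Set.Ioc 0 X))
    (F := fun (n : ℕ) (w : ℝ) => g n * w ^ (μ + n - 1))
    (fun n => by
      have := (hint n).const_mul (g n)
      rwa [intervalIntegrable_iff_integrableOn_Ioc_of_le hX] at this)
    (by
      have hs := (summable_norm_phi2Coeff hμ m a b X).mul_left (X ^ μ / μ)
      refine Summable.of_nonneg_of_le (fun n => by positivity) (fun n => ?_) hs
      have h1 : ∫ w in Set.Ioc 0 X, ‖g n * w ^ (μ + n - 1)‖ =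
          |g n| * (X ^ μ * X ^ n / (μ + n)) := by
        rw [← hterm n, intervalIntegral.integral_of_le hX, ← integral_const_mul]
        refine setIntegral_congr_fun measurableSet_Ioc fun w hw => ?_
        rw [norm_mul, Real.norm_eq_abs, Real.norm_of_nonneg (Real.rpow_nonneg hw.1.le _)]
      rw [h1, norm_mul, norm_pow, Real.norm_of_nonneg hX, Real.norm_eq_abs]
      calc |g n| * (X ^ μ * X ^ n / (μ + n)) ≤ |g n| * (X ^ μ * X ^ n / μ) := by
            gcongr; simp
        _ = _ := by ring)
  have hF : ∀ n : ℕ, ∫ w in Set.Ioc 0 X, g n * w ^ (μ + n - 1) =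
      X ^ μ / μ * (phi2Coeff (μ - m) m (-a) (b - a) n / (ascPochhammer ℝ n).eval (μ + 1) *
        X ^ n) := by
    intro n
    rw [integral_const_mul, ← intervalIntegral.integral_of_le hX, hterm n, hg]
    have h1 := pochhammer_pos hμ n
    have h2 := pochhammer_pos (show 0 < μ + 1 by positivity) n
    -- The factor `1 / (μ + n)` from integrating the power is what shifts the lower parameter from
    -- `μ` to `μ + 1`.
    have h3 : (ascPochhammer ℝ n).eval μ * (μ + n) = μ * (ascPochhammer ℝ n).eval (μ + 1) := by
      rw [← pochhammer_succ, add_comm n 1, pochhammer_add]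
      simp
    have h4 : 0 < μ + n := by positivity
    rw [div_mul_div_comm, h3]
    field_simp
  rw [humbertPhi2_eq_tsum _ _ (by positivity), ← tsum_mul_left, ← tsum_congr hF, key.tsum_eq,
    intervalIntegral.integral_of_le hX]
  refine setIntegral_congr_fun measurableSet_Ioc fun w hw => ?_
  rw [exp_mul_hyp1F1_eq hμ, ← tsum_mul_left]
  congr 1; ext n
  rw [show μ + (n : ℝ) - 1 = (μ - 1) + n by ring, Real.rpow_add_natCast hw.1.ne']
  ring

/-! ### The κ-μ law and its moment generating function -/

/-- The κ-μ distribution. -/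
noncomputable def kappaMu (μ p d : ℝ) : Measure ℝ :=
  (volume.restrict (Set.Ioi 0)).withDensity fun w => ENNReal.ofReal (kappaMuPDF μ p d w)

lemma measurable_ofReal_kappaMuPDF {μ : ℝ} (hμ : 0 < μ) (p d : ℝ) :
    Measurable fun w => ENNReal.ofReal (kappaMuPDF μ p d w) :=
  ((measurable_kappaMuPDF hμ).comp (by fun_prop : Measurable fun w : ℝ => (d, w))).ennreal_ofReal

lemma lintegral_kappaMu {μ p d : ℝ} (hμ : 0 < μ) {F : ℝ → ENNReal} (hF : Measurable F) :
    ∫⁻ w, F w ∂(kappaMu μ p d) =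
      ∫⁻ w in Set.Ioi 0, ENNReal.ofReal (kappaMuPDF μ p d w) * F w := by
  rw [kappaMu, lintegral_withDensity_eq_lintegral_mul _ (measurable_ofReal_kappaMuPDF hμ p d) hF]
  rfl

lemma lintegral_exp_kappaMu {μ p d t : ℝ} (hμ : 0 < μ) (hp : 0 < p) (hd : 0 ≤ d)
    (ht : t < 1 / p) : ∫⁻ w, ENNReal.ofReal (Real.exp (t * w)) ∂(kappaMu μ p d) =
      ENNReal.ofReal ((1 / (1 - p * t)) ^ μ * Real.exp (d * t / (1 - p * t))) := by
  rw [lintegral_kappaMu hμ (by fun_prop), ← lintegral_exp_mul_kappaMuPDF hμ hp hd ht]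
  refine lintegral_congr fun w => ?_
  rw [ENNReal.ofReal_mul (Real.exp_pos _).le, mul_comm]

lemma isProbabilityMeasure_kappaMu {μ p d : ℝ} (hμ : 0 < μ) (hp : 0 < p) (hd : 0 ≤ d) :
    IsProbabilityMeasure (kappaMu μ p d) := by
  have := lintegral_exp_kappaMu (t := 0) hμ hp hd (by positivity)
  constructor
  simpa using this

lemma integrable_exp_kappaMu {μ p d t : ℝ} (hμ : 0 < μ) (hp : 0 < p) (hd : 0 ≤ d)
    (ht : t < 1 / p) : Integrable (fun w => Real.exp (t * w)) (kappaMu μ p d) := by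
  refine ⟨by fun_prop, ?_⟩
  rw [hasFiniteIntegral_iff_ofReal (ae_of_all _ fun w => (Real.exp_pos _).le),
    lintegral_exp_kappaMu hμ hp hd ht]
  exact ENNReal.ofReal_lt_top

lemma one_sub_mul_pos {p t : ℝ} (hp : 0 < p) (ht : t < 1 / p) : 0 < 1 - p * t := by
  have := (lt_div_iff₀ hp).1 ht
  linarith

lemma mgf_kappaMu {μ p d t : ℝ} (hμ : 0 < μ) (hp : 0 < p) (hd : 0 ≤ d) (ht : t < 1 / p) :
    mgf id (kappaMu μ p d) t = (1 / (1 - p * t)) ^ μ * Real.exp (d * t / (1 - p * t)) := by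
  have h0 := one_sub_mul_pos hp ht
  unfold mgf
  simp only [id]
  rw [integral_eq_lintegral_of_nonneg_ae (ae_of_all _ fun w => (Real.exp_pos _).le) (by fun_prop),
    lintegral_exp_kappaMu hμ hp hd ht, ENNReal.toReal_ofReal (by positivity)]

/-! ### Gaussian vectors have κ-μ power -/

/-- Probability measures whose moment generating functions are finite and agree on `(-∞, c)` with
`c > 0` are equal. -/
lemma ext_of_mgf_eq_of_lt {ν ν' : Measure ℝ} [IsFiniteMeasure ν] [IsFiniteMeasure ν'] {c : ℝ}
    (hc : 0 < c) (h1 : ∀ t < c, Integrable (fun x => Real.exp (t * x)) ν)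
    (h2 : ∀ t < c, Integrable (fun x => Real.exp (t * x)) ν')
    (h : ∀ t < c, mgf id ν t = mgf id ν' t) : ν = ν' := by
  refine Measure.ext_of_charFun (funext fun w => ?_)
  rw [← complexMGF_id_mul_I, ← complexMGF_id_mul_I]
  -- Identity theorem: both complex transforms are analytic on this half-plane, which is connected
  -- and contains the imaginary axis. They agree at the real points `-1 / (n + 1)`, which accumulate
  -- at zero.
  set S : Set ℂ := {z | z.re < c} with hS
  have hsub : ∀ {κ : Measure ℝ}, (∀ t < c, Integrable (fun x => Real.exp (t * x)) κ) →
      AnalyticOnNhd ℂ (complexMGF id κ) S := by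
    intro κ hκ
    refine analyticOnNhd_complexMGF.mono fun z hz => ?_
    have : Set.Iio c ⊆ interior (integrableExpSet id κ) :=
      interior_maximal (fun t ht => hκ t ht) isOpen_Iio
    exact this hz
  have hconv : Convex ℝ S := convex_halfSpace_re_lt c
  refine AnalyticOnNhd.eqOn_of_preconnected_of_frequently_eq (hsub h1) (hsub h2)
    hconv.isPreconnected (z₀ := 0) (by simp [hS, hc]) ?_ (by simp [hS, hc])
  have hlim : Filter.Tendsto (fun n : ℕ => ((-(1 / ((n : ℝ) + 1)) : ℝ) : ℂ)) Filter.atTop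
      (nhdsWithin 0 {0}ᶜ) := by
    rw [tendsto_nhdsWithin_iff]
    constructor
    · have h3 := (tendsto_one_div_add_atTop_nhds_zero_nat (𝕜 := ℝ)).neg
      rw [neg_zero] at h3
      exact (Complex.continuous_ofReal.tendsto 0).comp h3
    · refine Filter.Eventually.of_forall fun n => ?_
      have : (-(1 / ((n : ℝ) + 1)) : ℝ) ≠ 0 := by
        have : (0 : ℝ) < n + 1 := by positivity
        simp [this.ne']
      rw [Set.mem_compl_singleton_iff]
      exact Complex.ofReal_ne_zero.2 this
  refine hlim.frequently (Filter.Frequently.of_forall fun n => ?_)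
  rw [complexMGF_ofReal, complexMGF_ofReal, h]
  have : 0 < 1 / ((n : ℝ) + 1) := by positivity
  linarith

/-- Completing the square gives a Gaussian centred at `t a / b` with `b = (1 - 2 v t) / (2 v)`,
positive exactly in the allowed range of `t`. -/
lemma integral_exp_sq_gaussianReal {v : NNReal} (hv : v ≠ 0) (a : ℝ) {t : ℝ}
    (ht : t < 1 / (2 * v)) : ∫ x, Real.exp (t * (a + x) ^ 2) ∂(gaussianReal 0 v) =
      Real.sqrt (1 / (1 - 2 * v * t)) * Real.exp (a ^ 2 * t / (1 - 2 * v * t)) := by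
  have hv' : 0 < (v : ℝ) := by positivity
  have h0 : 0 < 1 - 2 * v * t := one_sub_mul_pos (by positivity) ht
  set b := (1 - 2 * v * t) / (2 * v) with hb
  have hb0 : 0 < b := by positivity
  rw [integral_gaussianReal_eq_integral_smul hv]
  have : ∀ x : ℝ, gaussianPDFReal 0 v x • Real.exp (t * (a + x) ^ 2) =
      ((Real.sqrt (2 * Real.pi * v))⁻¹ * Real.exp (a ^ 2 * t / (1 - 2 * v * t))) *
        Real.exp (-b * (x - t * a / b) ^ 2) := by
    intro x
    rw [gaussianPDFReal_def, smul_eq_mul, mul_assoc _ (Real.exp _) (Real.exp _),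
      mul_assoc _ (Real.exp _) (Real.exp _), ← Real.exp_add, ← Real.exp_add]
    congr 2
    rw [hb]
    field_simp
    ring
  simp_rw [this]
  rw [integral_const_mul, integral_sub_right_eq_self (fun x => Real.exp (-b * x ^ 2)),
    integral_gaussian, mul_right_comm, ← Real.sqrt_inv, ← Real.sqrt_mul (by positivity)]
  congr 2
  rw [hb]
  field_simp

lemma sq_norm_add (A : ℂ) (x y : ℝ) :
    ‖A + (x + Complex.I * y)‖ ^ 2 = (A.re + x) ^ 2 + (A.im + y) ^ 2 := by
  rw [← Complex.normSq_eq_norm_sq, Complex.normSq_apply]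
  simp
  ring

/-- The squared norm of a complex Gaussian vector with independent components and mean `A`
follows the κ-μ distribution. -/
lemma map_sum_sq_norm_gaussian {n : ℕ} (hn : 0 < n) {v : NNReal} (hv : v ≠ 0) (A : Fin n → ℂ) :
    ((Measure.pi fun _ : Fin n => gaussianReal 0 v).prod
      (Measure.pi fun _ : Fin n => gaussianReal 0 v)).map
        (fun q => ∑ i, ‖A i + (q.1 i + Complex.I * q.2 i)‖ ^ 2) =
      kappaMu n (2 * v) (∑ i, ‖A i‖ ^ 2) := by
  have hv' : 0 < (v : ℝ) := by positivity
  have hp : 0 < 2 * (v : ℝ) := by positivity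
  have hn' : (0 : ℝ) < n := by exact_mod_cast hn
  have hd : 0 ≤ ∑ i, ‖A i‖ ^ 2 := by positivity
  have hmeas : Measurable fun q : (Fin n → ℝ) × (Fin n → ℝ) =>
      ∑ i, ‖A i + (q.1 i + Complex.I * q.2 i)‖ ^ 2 := by fun_prop
  have := isProbabilityMeasure_kappaMu hn' hp hd
  have hprob : IsProbabilityMeasure (((Measure.pi fun _ : Fin n => gaussianReal 0 v).prod
      (Measure.pi fun _ : Fin n => gaussianReal 0 v)).map
        (fun q => ∑ i, ‖A i + (q.1 i + Complex.I * q.2 i)‖ ^ 2)) :=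
    Measure.isProbabilityMeasure_map hmeas.aemeasurable
  have hmgf : ∀ t < 1 / (2 * (v : ℝ)), mgf id (((Measure.pi fun _ : Fin n => gaussianReal 0 v).prod
      (Measure.pi fun _ : Fin n => gaussianReal 0 v)).map
        (fun q => ∑ i, ‖A i + (q.1 i + Complex.I * q.2 i)‖ ^ 2)) t =
      (1 / (1 - 2 * v * t)) ^ (n : ℝ) *
        Real.exp ((∑ i, ‖A i‖ ^ 2) * t / (1 - 2 * v * t)) := by
    intro t ht
    have h0 : 0 < 1 - 2 * v * t := one_sub_mul_pos (by positivity) ht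
    rw [mgf_id_map hmeas.aemeasurable]
    unfold mgf
    -- The exponent separates over the `2n` real coordinates, so the expectation factors into
    -- one-dimensional integrals.
    have : ∀ q : (Fin n → ℝ) × (Fin n → ℝ),
        Real.exp (t * ∑ i, ‖A i + (q.1 i + Complex.I * q.2 i)‖ ^ 2) =
        (∏ i, Real.exp (t * ((A i).re + q.1 i) ^ 2)) *
          ∏ i, Real.exp (t * ((A i).im + q.2 i) ^ 2) := by
      intro q
      rw [← Real.exp_sum, ← Real.exp_sum, ← Real.exp_add, ← Finset.sum_add_distrib, Finset.mul_sum]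
      congr 1
      refine Finset.sum_congr rfl fun i _ => ?_
      rw [sq_norm_add]
      ring
    simp_rw [this]
    rw [integral_prod_mul (fun x : Fin n → ℝ => ∏ i, Real.exp (t * ((A i).re + x i) ^ 2))
      (fun y : Fin n → ℝ => ∏ i, Real.exp (t * ((A i).im + y i) ^ 2)),
      integral_fintype_prod_eq_prod (fun i x => Real.exp (t * ((A i).re + x) ^ 2)),
      integral_fintype_prod_eq_prod (fun i x => Real.exp (t * ((A i).im + x) ^ 2)),
      ← Finset.prod_mul_distrib]
    simp_rw [integral_exp_sq_gaussianReal hv _ ht]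
    have hi : ∀ i, Real.sqrt (1 / (1 - 2 * v * t)) * Real.exp ((A i).re ^ 2 * t / (1 - 2 * v * t)) *
        (Real.sqrt (1 / (1 - 2 * v * t)) * Real.exp ((A i).im ^ 2 * t / (1 - 2 * v * t))) =
        (1 / (1 - 2 * v * t)) * Real.exp (‖A i‖ ^ 2 * t / (1 - 2 * v * t)) := by
      intro i
      rw [mul_mul_mul_comm, Real.mul_self_sqrt (by positivity), ← Real.exp_add,
        ← Complex.normSq_eq_norm_sq, Complex.normSq_apply]
      congr 2
      ring
    simp_rw [hi]
    rw [Finset.prod_mul_distrib, ← Real.exp_sum, Finset.prod_const, Finset.card_univ,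
      Fintype.card_fin, Real.rpow_natCast, ← Finset.sum_div, ← Finset.sum_mul]
  refine ext_of_mgf_eq_of_lt (c := 1 / (2 * (v : ℝ))) (by positivity) (fun t ht => ?_)
    (fun t ht => integrable_exp_kappaMu hn' hp hd ht) (fun t ht => ?_)
  -- Without integrability the generating function would be zero, contradicting its positive value.
  · by_contra hcon
    have h1 := hmgf t ht
    have h0 : 0 < 1 - 2 * v * t := one_sub_mul_pos (by positivity) ht
    have h2 := mgf_undef (X := id) hcon
    rw [h2] at h1
    have : 0 < (1 / (1 - 2 * v * t)) ^ (n : ℝ) *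
        Real.exp ((∑ i, ‖A i‖ ^ 2) * t / (1 - 2 * v * t)) := by positivity
    linarith
  · rw [hmgf t ht, mgf_kappaMu hn' hp hd ht]

/-! ### Reduction of the physical model to the generalized model -/

instance isProbabilityMeasure_uniformPhase : IsProbabilityMeasure uniformPhase :=
  cond_isProbabilityMeasure_of_finite (by simp [Real.pi_pos]) measure_Ioo_lt_top.ne

lemma ae_nonneg_gammaMeasure (a r : ℝ) : ∀ᵐ z ∂(gammaMeasure a r), 0 ≤ z := by
  rw [gammaMeasure, ae_withDensity_iff (f := gammaPDF a r) (measurable_gammaPDFReal a r).ennreal_ofReal]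
  refine ae_of_all _ fun z hz => ?_
  by_contra hcon
  exact hz (gammaPDF_of_neg (not_le.1 hcon))

/-- The dominant power of the first cluster before shadowing. -/
noncomputable def twoWavePower (V₁ V₂ f₁ f₂ : ℝ) : ℝ :=
  ‖(V₁ : ℂ) * Complex.exp (Complex.I * f₁) + V₂ * Complex.exp (Complex.I * f₂)‖ ^ 2

lemma lintegral_prod_four {α β γ δ : Type*} [MeasurableSpace α] [MeasurableSpace β]
    [MeasurableSpace γ] [MeasurableSpace δ] (a : Measure α) (b : Measure β) (c : Measure γ)
    (d : Measure δ) [SFinite b] [SFinite c] [SFinite d] {F : α × β × γ × δ → ENNReal}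
    (hF : Measurable F) : ∫⁻ q, F q ∂(a.prod (b.prod (c.prod d))) =
      ∫⁻ x, ∫⁻ y, ∫⁻ z, ∫⁻ w, F (x, y, z, w) ∂d ∂c ∂b ∂a := by
  rw [lintegral_prod _ hF.aemeasurable]
  refine lintegral_congr fun x => ?_
  have h1 : Measurable fun q => F (x, q) := hF.comp measurable_prodMk_left
  rw [lintegral_prod _ h1.aemeasurable]
  refine lintegral_congr fun y => ?_
  have h2 : Measurable fun q => F (x, y, q) := h1.comp measurable_prodMk_left
  rw [lintegral_prod _ h2.aemeasurable]

lemma measurable_generalizedDensity {μ : ℝ} (hμ : 0 < μ) (V₁ V₂ S p : ℝ) :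
    Measurable fun q : ℝ × ℝ × ℝ × ℝ => ENNReal.ofReal (kappaMuPDF μ p
      (q.1 * (‖(V₁ : ℂ) * Complex.exp (Complex.I * q.2.1)
            + V₂ * Complex.exp (Complex.I * q.2.2.1)‖ ^ 2 + S)) q.2.2.2) :=
  ((measurable_kappaMuPDF (p := p) hμ).comp (by fun_prop : Measurable fun q : ℝ × ℝ × ℝ × ℝ =>
    ((q.1 * (‖(V₁ : ℂ) * Complex.exp (Complex.I * q.2.1)
            + V₂ * Complex.exp (Complex.I * q.2.2.1)‖ ^ 2 + S)), q.2.2.2))).ennreal_ofReal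

variable {Ω : Type*} [MeasurableSpace Ω]

/-- Expectations in the generalized model. -/
lemma GeneralizedModel.lintegral_eq {P : Measure Ω} {μ V₁ V₂ S σ m : ℝ} {ζ φ₁ φ₂ W : Ω → ℝ}
    (h : GeneralizedModel P μ V₁ V₂ S σ m ζ φ₁ φ₂ W) (hμ : 0 < μ) (hm : 0 < m)
    {F : ℝ × ℝ × ℝ × ℝ → ENNReal} (hF : Measurable F) :
    ∫⁻ ω, F (ζ ω, φ₁ ω, φ₂ ω, W ω) ∂P =
      ∫⁻ z, ∫⁻ f₁, ∫⁻ f₂, ∫⁻ w in Set.Ioi 0, ENNReal.ofReal (kappaMuPDF μ (2 * σ ^ 2)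
        (z * (twoWavePower V₁ V₂ f₁ f₂ + S)) w) * F (z, f₁, f₂, w)
        ∂volume ∂uniformPhase ∂uniformPhase ∂(gammaMeasure m m) := by
  have := isProbabilityMeasure_gammaMeasure hm hm
  have hD := measurable_generalizedDensity hμ V₁ V₂ S (2 * σ ^ 2)
  have hDF := hD.mul hF
  rw [← lintegral_map' hF.aemeasurable h.law.aemeasurable, h.law.map_eq,
    lintegral_withDensity_eq_lintegral_mul _ hD hF, lintegral_prod_four _ _ _ _ hDF]
  rfl

/-- The physical model with `k + 1` clusters is the generalized model with `μ = k + 1`. -/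
lemma ClusterModel.generalizedModel {P : Measure Ω} {k : ℕ} {V₁ V₂ : ℝ} {U : Fin k → ℝ} {σ m : ℝ}
    {ζ φ₁ φ₂ : Ω → ℝ} {φ : Fin k → Ω → ℝ} {X Y : Fin (k + 1) → Ω → ℝ} {W : Ω → ℝ}
    (h : ClusterModel P k V₁ V₂ U σ m ζ φ₁ φ₂ φ X Y W) (hσ : 0 < σ) (hm : 0 < m) :
    GeneralizedModel P (k + 1) V₁ V₂ (∑ i, U i ^ 2) σ m ζ φ₁ φ₂ W := by
  have hμ : (0 : ℝ) < k + 1 := by positivity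
  have := isProbabilityMeasure_gammaMeasure hm hm
  set v : NNReal := Real.toNNReal (σ ^ 2) with hvdef
  have hv : (v : ℝ) = σ ^ 2 := Real.coe_toNNReal _ (by positivity)
  have hv0 : v ≠ 0 := by
    intro h0
    rw [h0] at hv
    have : 0 < σ ^ 2 := by positivity
    rw [← hv] at this
    simp at this
  set A : ℝ → ℝ → ℝ → (Fin k → ℝ) → Fin (k + 1) → ℂ := fun z f₁ f₂ f =>
    Fin.cons ((Real.sqrt z : ℂ) * (V₁ * Complex.exp (Complex.I * f₁)
        + V₂ * Complex.exp (Complex.I * f₂)))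
      fun i => (Real.sqrt z : ℂ) * (U i * Complex.exp (Complex.I * f i)) with hA
  set T : ℝ × ℝ × ℝ × (Fin k → ℝ) × (Fin (k + 1) → ℝ) × (Fin (k + 1) → ℝ) → ℝ × ℝ × ℝ × ℝ :=
    fun q => (q.1, q.2.1, q.2.2.1, ∑ i, ‖A q.1 q.2.1 q.2.2.1 q.2.2.2.1 i +
      (q.2.2.2.2.1 i + Complex.I * q.2.2.2.2.2 i)‖ ^ 2) with hT
  have hTm : Measurable T := by
    simp only [hT, hA, Fin.sum_univ_succ, Fin.cons_zero, Fin.cons_succ]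
    fun_prop
  have hWT : (fun ω => (ζ ω, φ₁ ω, φ₂ ω, W ω)) = fun ω =>
      T (ζ ω, φ₁ ω, φ₂ ω, (fun i => φ i ω), (fun i => X i ω), (fun i => Y i ω)) := by
    funext ω
    simp only [hT, hA, Fin.sum_univ_succ, Fin.cons_zero, Fin.cons_succ]
    rw [h.power_eq]
  have hD := measurable_generalizedDensity hμ V₁ V₂ (∑ i, U i ^ 2) (2 * σ ^ 2)
  refine ⟨⟨?_, ?_⟩⟩
  · rw [hWT]
    exact hTm.comp_aemeasurable h.law.aemeasurable
  rw [hWT]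
  refine (AEMeasurable.map_map_of_aemeasurable hTm.aemeasurable h.law.aemeasurable).symm.trans ?_
  rw [h.law.map_eq]
  refine Measure.ext_of_lintegral _ fun F hF => ?_
  have hFT := hF.comp hTm
  have hDF := hD.mul hF
  rw [lintegral_map hF hTm, lintegral_withDensity_eq_lintegral_mul _ hD hF]
  change ∫⁻ q, (F ∘ T) q ∂_ = _
  rw [lintegral_prod_four _ _ _ _ hDF, lintegral_prod_four _ _ _ _ hFT]
  -- Nonnegativity of `z` is needed for `√z ^ 2 = z` in `hsum`.
  refine lintegral_congr_ae ((ae_nonneg_gammaMeasure m m).mono fun z hz => ?_)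
  refine lintegral_congr fun f₁ => lintegral_congr fun f₂ => ?_
  have hFT' : Measurable fun q => (F ∘ T) (z, f₁, f₂, q) := hFT.comp (by fun_prop)
  rw [lintegral_prod _ hFT'.aemeasurable]
  -- The right-hand side is free of `f`: the phases of the other clusters do not affect the norm of
  -- the mean vector, so they integrate out.
  have hinner : ∀ f : Fin k → ℝ, ∫⁻ q : (Fin (k + 1) → ℝ) × (Fin (k + 1) → ℝ),
      F (T (z, f₁, f₂, f, q)) ∂((Measure.pi fun _ : Fin (k + 1) => gaussianReal 0 v).prod
          (Measure.pi fun _ : Fin (k + 1) => gaussianReal 0 v)) =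
      ∫⁻ w in Set.Ioi 0, ENNReal.ofReal (kappaMuPDF (k + 1) (2 * σ ^ 2)
        (z * (twoWavePower V₁ V₂ f₁ f₂ + ∑ i, U i ^ 2)) w) * F (z, f₁, f₂, w) := by
    intro f
    have hFm : Measurable fun w => F (z, f₁, f₂, w) := hF.comp (by fun_prop)
    have hlaw := map_sum_sq_norm_gaussian k.succ_pos hv0 (A z f₁ f₂ f)
    have hsum : ∑ i, ‖A z f₁ f₂ f i‖ ^ 2 = z * (twoWavePower V₁ V₂ f₁ f₂ + ∑ i, U i ^ 2) := by
      have he : ∀ x : ℝ, ‖Complex.exp (Complex.I * x)‖ = 1 := fun x => by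
        rw [mul_comm]; exact Complex.norm_exp_ofReal_mul_I x
      simp only [hA, Fin.sum_univ_succ, Fin.cons_zero, Fin.cons_succ, norm_mul, he, mul_pow,
        Complex.norm_real, Real.norm_eq_abs, sq_abs, Real.sq_sqrt hz, mul_one,
        twoWavePower]
      rw [← Finset.mul_sum, mul_add]
    rw [hsum, hv] at hlaw
    push_cast at hlaw
    rw [← lintegral_kappaMu hμ hFm, ← hlaw, lintegral_map hFm (by fun_prop)]
  have hconst : ∀ f : Fin k → ℝ, ∫⁻ q : (Fin (k + 1) → ℝ) × (Fin (k + 1) → ℝ),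
      (F ∘ T) (z, f₁, f₂, f, q) ∂((Measure.pi fun _ : Fin (k + 1) => gaussianReal 0 v).prod
          (Measure.pi fun _ : Fin (k + 1) => gaussianReal 0 v)) = _ := hinner
  refine (lintegral_congr hconst).trans ?_
  rw [lintegral_const, measure_univ, mul_one]
  rfl

/-! ### The shadowed law and its explicit density and distribution function -/

/-- The κ-μ shadowed density in terms of the diffuse power `p` per cluster and the ratio `s` of the
mean dominant power to `p`. -/
noncomputable def shadowedPDF (μ m p s w : ℝ) : ℝ :=
  (1 / p) ^ μ * w ^ (μ - 1) * Real.exp (-(w / p)) / Real.Gamma μ *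
    (m / (s + m)) ^ m * hyp1F1 m μ (s / (s + m) * (w / p))

lemma shadowedPDF_nonneg {μ m p s w : ℝ} (hμ : 0 < μ) (hm : 0 < m) (hp : 0 < p) (hs : 0 ≤ s)
    (hw : 0 ≤ w) : 0 ≤ shadowedPDF μ m p s w := by
  have := hyp1F1_nonneg hm hμ (show 0 ≤ s / (s + m) * (w / p) by positivity)
  have hG := Real.Gamma_pos_of_pos hμ
  unfold shadowedPDF
  positivity

/-- This is the density of a scaled variable: the diffuse power scales by `c`, while the power ratio
`s` is unchanged. -/
lemma mul_shadowedPDF_mul {μ m p s w c : ℝ} (hc : 0 < c) (hp : 0 < p)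
    (hw : 0 < w) : c * shadowedPDF μ m (c * p) s (c * w) = shadowedPDF μ m p s w := by
  have e1 : c * w / (c * p) = w / p := by field_simp
  have e2 : c * ((1 / (c * p)) ^ μ * (c * w) ^ (μ - 1)) = (1 / p) ^ μ * w ^ (μ - 1) := by
    rw [one_div, one_div, Real.inv_rpow (by positivity), Real.inv_rpow (by positivity),
      Real.mul_rpow hc.le hp.le, Real.mul_rpow hc.le hw.le, Real.rpow_sub_one hc.ne']
    have := Real.rpow_pos_of_pos hc μ
    have := Real.rpow_pos_of_pos hp μ
    field_simp
  unfold shadowedPDF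
  rw [e1]
  linear_combination (Real.exp (-(w / p)) / Real.Gamma μ *
    (m / (s + m)) ^ m * hyp1F1 m μ (s / (s + m) * (w / p))) * e2

lemma condPDF_eq_shadowedPDF {K m μ Δ gbar θ x : ℝ} (hm : 0 < m) (hμ : 0 < μ) (hK : 0 ≤ K)
    (hg : 0 < gbar) (hκ : 0 ≤ kappa K Δ θ) (hx : 0 ≤ x) :
    condPDF K m μ Δ gbar θ x =
      shadowedPDF μ m (gbar / (μ * (1 + K))) (μ * kappa K Δ θ) x := by
  unfold condPDF shadowedPDF
  have hs : μ * K * (1 + Δ * Real.cos θ) = μ * kappa K Δ θ := by rw [kappa]; ring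
  have hs2 : μ ^ 2 * K * (1 + Δ * Real.cos θ) = μ * (μ * kappa K Δ θ) := by rw [kappa]; ring
  have hs0 : 0 ≤ μ * kappa K Δ θ := by positivity
  rw [hs, hs2]
  set s := μ * kappa K Δ θ
  have e1 : -(μ * (1 + K) / gbar) * x = -(x / (gbar / (μ * (1 + K)))) := by field_simp
  have e2 : μ * s * (1 + K) / (s + m) * (x / gbar) =
      s / (s + m) * (x / (gbar / (μ * (1 + K)))) := by field_simp
  have e3 : μ ^ μ * (1 + K) ^ μ / gbar * (x / gbar) ^ (μ - 1) =
      (1 / (gbar / (μ * (1 + K)))) ^ μ * x ^ (μ - 1) := by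
    rw [one_div_div, Real.div_rpow hx hg.le, Real.div_rpow (by positivity) hg.le,
      Real.mul_rpow hμ.le (by positivity), Real.rpow_sub_one hg.ne']
    have := Real.rpow_pos_of_pos hg μ
    field_simp
  rw [e1, e2, ← e3, Real.div_rpow hm.le (by positivity)]
  generalize hyp1F1 m μ _ = H
  generalize Real.exp _ = E'
  have hG := Real.Gamma_pos_of_pos hμ
  have h5 : 0 < (s + m) ^ m := by positivity
  field_simp

/-- With `q` the diffuse power, take `a = 1 / q` and `b = s / ((s + m) q)` in the `Φ₂` integral;
then `b - a = -m / ((s + m) q)` is the coefficient in its last argument. -/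
lemma condCDF_eq_integral {K m μ Δ gbar θ x : ℝ} (hm : 0 < m) (hμ : 0 < μ) (hK : 0 ≤ K)
    (hg : 0 < gbar) (hκ : 0 ≤ kappa K Δ θ) (hx : 0 ≤ x) :
    IntervalIntegrable (shadowedPDF μ m (gbar / (μ * (1 + K))) (μ * kappa K Δ θ)) volume 0 x ∧
    ∫ w in (0 : ℝ)..x, shadowedPDF μ m (gbar / (μ * (1 + K))) (μ * kappa K Δ θ) w =
      condCDF K m μ Δ gbar θ x := by
  unfold condCDF
  have hs : μ * K * (1 + Δ * Real.cos θ) = μ * kappa K Δ θ := by rw [kappa]; ring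
  have hs0 : 0 ≤ μ * kappa K Δ θ := by positivity
  rw [hs]
  set s := μ * kappa K Δ θ
  set q := gbar / (μ * (1 + K)) with hq
  have hq0 : 0 < q := by positivity
  have hfun : shadowedPDF μ m q s = fun w => ((1 / q) ^ μ / Real.Gamma μ * (m / (s + m)) ^ m) *
      (w ^ (μ - 1) * (Real.exp (-(1 / q * w)) * hyp1F1 m μ (s / (s + m) / q * w))) := by
    funext w
    unfold shadowedPDF
    have e1 : -(w / q) = -(1 / q * w) := by ring
    have e2 : s / (s + m) * (w / q) = s / (s + m) / q * w := by ring
    rw [e1, e2]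
    ring
  rw [hfun]
  refine ⟨(integrableOn_rpow_mul_exp_mul_hyp1F1 hμ m _ _ x).const_mul _, ?_⟩
  rw [intervalIntegral.integral_const_mul, integral_rpow_mul_exp_mul_hyp1F1 hμ m _ _ hx]
  have e1 : -(1 / q) * x = -(μ * (1 + K) * x / gbar) := by rw [hq]; field_simp
  have e2 : (s / (s + m) / q - 1 / q) * x = -(μ * (1 + K) / gbar) * (m * x / (s + m)) := by
    rw [hq]
    field_simp
    ring
  rw [e1, e2]
  have e3 : (1 / q) ^ μ * x ^ μ = μ ^ μ * (1 + K) ^ μ * (x / gbar) ^ μ := by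
    rw [hq, one_div_div, ← Real.mul_rpow (by positivity) hx,
      ← Real.mul_rpow hμ.le (by positivity), ← Real.mul_rpow (by positivity) (by positivity)]
    congr 1
    field_simp
  rw [Real.div_rpow hm.le (by positivity), Real.rpow_sub_one hμ.ne']
  generalize humbertPhi2 _ _ _ _ _ = H
  have hG := Real.Gamma_pos_of_pos hμ
  have h5 : 0 < (s + m) ^ m := by positivity
  linear_combination (m ^ m / (Real.Gamma μ * (s + m) ^ m) / μ * H) * e3

/-- Mixing the κ-μ density over the shadowing. -/
lemma lintegral_kappaMuPDF_gamma_eq_shadowedPDF {μ p s m w : ℝ} (hμ : 0 < μ) (hp : 0 < p)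
    (hs : 0 ≤ s) (hm : 0 < m) (hw : 0 < w) :
    ∫⁻ z, ENNReal.ofReal (kappaMuPDF μ p (z * (s * p)) w) ∂(gammaMeasure m m) =
      ENNReal.ofReal (shadowedPDF μ m p s w) := by
  rw [lintegral_kappaMuPDF_gamma hμ hp (by positivity) hm hw, mul_div_cancel_right₀ _ hp.ne']
  rfl

lemma measurable_condPDF (K m Δ gbar : ℝ) {μ : ℝ} (hμ : 0 < μ) :
    Measurable fun q : ℝ × ℝ => condPDF K m μ Δ gbar q.1 q.2 := by
  unfold condPDF
  exact Measurable.mul (by fun_prop) ((continuous_hyp1F1 m hμ).measurable.comp (by fun_prop))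

lemma continuous_condPDF {K m μ Δ gbar : ℝ} (hm : 0 < m) (hμ : 0 < μ)
    (hκ : ∀ θ, 0 ≤ kappa K Δ θ) (x : ℝ) : Continuous fun θ => condPDF K m μ Δ gbar θ x := by
  have hpos : ∀ θ, 0 < μ * K * (1 + Δ * Real.cos θ) + m := fun θ => by
    have := mul_nonneg hμ.le (hκ θ)
    rw [kappa, ← mul_assoc] at this
    linarith
  by_cases hgm : Real.Gamma μ * gbar = 0
  · simp [condPDF, hgm, continuous_const]
  have hne : ∀ θ, Real.Gamma μ * gbar * (μ * K * (1 + Δ * Real.cos θ) + m) ^ m ≠ 0 := fun θ =>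
    mul_ne_zero hgm (Real.rpow_pos_of_pos (hpos θ) m).ne'
  have hc := continuous_hyp1F1 m hμ
  unfold condPDF
  refine Continuous.mul (Continuous.mul (Continuous.mul (Continuous.div (by fun_prop) ?_ hne)
    continuous_const) continuous_const) (hc.comp ?_)
  · refine Continuous.mul continuous_const ?_
    exact Continuous.rpow_const (by fun_prop) fun θ => Or.inl (hpos θ).ne'
  · refine Continuous.mul (Continuous.div (by fun_prop) (by fun_prop) fun θ => (hpos θ).ne')
      continuous_const

lemma one_add_mul_cos_nonneg {Δ : ℝ} (h0 : 0 ≤ Δ) (h1 : Δ ≤ 1) (θ : ℝ) :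
    0 ≤ 1 + Δ * Real.cos θ := by
  nlinarith [Real.neg_one_le_cos θ]

lemma kappaMuShadowed_eq_shadowedPDF {κ μ m g : ℝ} (hκ : 0 ≤ κ) (hμ : 0 < μ) (hm : 0 < m)
    (hg : 0 < g) : kappaMuShadowed κ μ m g = (volume.restrict (Set.Ioi 0)).withDensity
      fun w => ENNReal.ofReal (shadowedPDF μ m (g / (μ * (1 + κ))) (μ * κ) w) := by
  unfold kappaMuShadowed
  refine withDensity_congr_ae ((ae_restrict_iff' measurableSet_Ioi).2 (ae_of_all _ fun w hw => ?_))
  exact lintegral_kappaMuPDF_gamma_eq_shadowedPDF hμ (by positivity) (by positivity) hm hw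

/-- By Tonelli, a mixture of κ-μ probability laws. It serves to bound the conditional CDF by one,
uniformly in `θ`. -/
lemma isProbabilityMeasure_kappaMuShadowed {κ μ m g : ℝ} (hκ : 0 ≤ κ) (hμ : 0 < μ) (hm : 0 < m)
    (hg : 0 < g) : IsProbabilityMeasure (kappaMuShadowed κ μ m g) := by
  have := isProbabilityMeasure_gammaMeasure hm hm
  constructor
  have hp : 0 < g / (μ * (1 + κ)) := by positivity
  rw [kappaMuShadowed, withDensity_apply _ MeasurableSet.univ, Measure.restrict_univ,
    lintegral_lintegral_swap]
  · have : ∀ᵐ z ∂(gammaMeasure m m), ∫⁻ w in Set.Ioi 0, ENNReal.ofReal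
        (kappaMuPDF μ (g / (μ * (1 + κ))) (z * (μ * κ * (g / (μ * (1 + κ))))) w) = 1 := by
      refine (ae_nonneg_gammaMeasure m m).mono fun z hz => ?_
      have h1 := (isProbabilityMeasure_kappaMu (d := z * (μ * κ * (g / (μ * (1 + κ))))) hμ hp
        (by positivity)).measure_univ
      rwa [kappaMu, withDensity_apply _ MeasurableSet.univ, Measure.restrict_univ] at h1
    rw [lintegral_congr_ae this, lintegral_one, measure_univ]
  · exact ((measurable_kappaMuPDF hμ).comp (by fun_prop : Measurable fun q : ℝ × ℝ =>
      (q.2 * (μ * κ * (g / (μ * (1 + κ)))), q.1))).ennreal_ofReal.aemeasurable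

section Conditional

variable {K m μ Δ gbar : ℝ} (hm : 0 < m) (hμ : 0 < μ) (hK : 0 ≤ K) (hg : 0 < gbar) {θ : ℝ}
  (hκ : 0 ≤ kappa K Δ θ)
include hm hμ hK hg hκ

lemma condPDF_nonneg {x : ℝ} (hx : 0 ≤ x) : 0 ≤ condPDF K m μ Δ gbar θ x := by
  rw [condPDF_eq_shadowedPDF hm hμ hK hg hκ hx]
  exact shadowedPDF_nonneg hμ hm (by positivity) (by positivity) hx

lemma kappaMuShadowed_eq_condPDF :
    kappaMuShadowed (kappa K Δ θ) μ m (gbar * (1 + kappa K Δ θ) / (1 + K)) =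
        (volume.restrict (Set.Ioi 0)).withDensity
          (fun x => ENNReal.ofReal (condPDF K m μ Δ gbar θ x)) := by
  rw [kappaMuShadowed_eq_shadowedPDF hκ hμ hm (by positivity)]
  refine withDensity_congr_ae ((ae_restrict_iff' measurableSet_Ioi).2 (ae_of_all _ fun w hw => ?_))
  rw [Set.mem_Ioi] at hw
  simp only
  rw [condPDF_eq_shadowedPDF hm hμ hK hg hκ hw.le]
  -- The mean is chosen proportional to `1 + κ_θ`, so the diffuse power `gbar / (μ (1 + K))` is the
  -- same for every `θ`.
  congr 2
  field_simp

lemma condCDF_nonneg {x : ℝ} (hx : 0 ≤ x) : 0 ≤ condCDF K m μ Δ gbar θ x := by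
  rw [← (condCDF_eq_integral hm hμ hK hg hκ hx).2]
  exact intervalIntegral.integral_nonneg hx fun w hw =>
    shadowedPDF_nonneg hμ hm (by positivity) (by positivity) hw.1

lemma lintegral_condPDF_Ioc {x : ℝ} (hx : 0 ≤ x) :
    ∫⁻ w in Set.Ioc 0 x, ENNReal.ofReal (condPDF K m μ Δ gbar θ w) =
      ENNReal.ofReal (condCDF K m μ Δ gbar θ x) := by
  have h := condCDF_eq_integral hm hμ hK hg hκ hx
  rw [← h.2, intervalIntegral.integral_of_le hx, ofReal_integral_eq_lintegral_ofReal]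
  · refine setLIntegral_congr_fun measurableSet_Ioc fun w hw => ?_
    rw [condPDF_eq_shadowedPDF hm hμ hK hg hκ hw.1.le]
  · exact (intervalIntegrable_iff_integrableOn_Ioc_of_le hx).1 h.1
  · exact (ae_restrict_iff' measurableSet_Ioc).2 (ae_of_all _ fun w hw =>
      shadowedPDF_nonneg hμ hm (by positivity) (by positivity) hw.1.le)

lemma kappaMuShadowed_Iic {x : ℝ} (hx : 0 ≤ x) :
    kappaMuShadowed (kappa K Δ θ) μ m (gbar * (1 + kappa K Δ θ) / (1 + K)) (Set.Iic x) =
      ENNReal.ofReal (condCDF K m μ Δ gbar θ x) := by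
  rw [kappaMuShadowed_eq_condPDF hm hμ hK hg hκ, withDensity_apply _ measurableSet_Iic,
    Measure.restrict_restrict measurableSet_Iic, Set.inter_comm, Set.Ioi_inter_Iic,
    lintegral_condPDF_Ioc hm hμ hK hg hκ hx]

lemma condCDF_le_one {x : ℝ} (hx : 0 ≤ x) : condCDF K m μ Δ gbar θ x ≤ 1 := by
  have := isProbabilityMeasure_kappaMuShadowed (g := gbar * (1 + kappa K Δ θ) / (1 + K))
    hκ hμ hm (by positivity)
  have h := prob_le_one (μ := kappaMuShadowed (kappa K Δ θ) μ m
    (gbar * (1 + kappa K Δ θ) / (1 + K))) (s := Set.Iic x)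
  rw [kappaMuShadowed_Iic hm hμ hK hg hκ hx] at h
  exact ENNReal.ofReal_le_one.1 h

end Conditional

/-- Measurability in `θ` comes from the CDF being a parametric integral of a jointly measurable
density, which avoids studying the double series. -/
lemma measurable_condCDF {K m μ Δ gbar : ℝ} (hm : 0 < m) (hμ : 0 < μ) (hK : 0 ≤ K) (hg : 0 < gbar)
    (hκ : ∀ θ, 0 ≤ kappa K Δ θ) {x : ℝ} (hx : 0 ≤ x) :
    Measurable fun θ => condCDF K m μ Δ gbar θ x := by
  have h1 : Measurable fun θ =>
      (∫⁻ w in Set.Ioc 0 x, ENNReal.ofReal (condPDF K m μ Δ gbar θ w)).toReal :=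
    (measurable_condPDF K m Δ gbar hμ).ennreal_ofReal.lintegral_prod_right'.ennreal_toReal
  convert h1 using 2 with θ
  rw [lintegral_condPDF_Ioc hm hμ hK hg (hκ θ) hx,
    ENNReal.toReal_ofReal (condCDF_nonneg hm hμ hK hg (hκ θ) hx)]

/-! ### Averages over a uniform phase -/

lemma lintegral_uniformPhase (G : ℝ → ENNReal) : ∫⁻ θ, G θ ∂uniformPhase =
    (ENNReal.ofReal (2 * Real.pi))⁻¹ * ∫⁻ θ in Set.Ioc 0 (2 * Real.pi), G θ := by
  rw [uniformPhase, ProbabilityTheory.cond, lintegral_smul_measure, Real.volume_Ioo, sub_zero,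
    smul_eq_mul, setLIntegral_congr Ioo_ae_eq_Ioc]

/-- The uniform phase is invariant under rotation. -/
lemma lintegral_toIcoMod_sub (G : ℝ → ENNReal) (a : ℝ) :
    ∫⁻ f, G (toIcoMod Real.two_pi_pos 0 (f - a)) ∂uniformPhase = ∫⁻ θ, G θ ∂uniformPhase := by
  set H : ℝ → ENNReal := fun x => G (toIcoMod Real.two_pi_pos 0 x) with hH
  have hper : Function.Periodic H (2 * Real.pi) := fun x => by
    simp only [hH, toIcoMod_periodic Real.two_pi_pos 0 x]
  rw [lintegral_uniformPhase, lintegral_uniformPhase]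
  congr 1
  have h1 : ∫⁻ f in Set.Ioc 0 (2 * Real.pi), H (f - a) =
      ∫⁻ x in Set.Ioc (-a) (-a + 2 * Real.pi), H x := by
    have := (measurePreserving_sub_right (volume : Measure ℝ) a).setLIntegral_comp_preimage_emb
      (MeasurableEquiv.subRight a).measurableEmbedding H (Set.Ioc (-a) (-a + 2 * Real.pi))
    rw [← this]
    congr 2
    ext x
    simp only [Set.mem_Ioc, Set.mem_preimage]
    constructor <;> rintro ⟨h1, h2⟩ <;> constructor <;> linarith
  -- A periodic function has the same integral over any two fundamental domains of `2πℤ`.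
  have h2 := (isAddFundamentalDomain_Ioc Real.two_pi_pos (-a)).setLIntegral_eq
    (isAddFundamentalDomain_Ioc Real.two_pi_pos 0) H hper.map_vadd_zmultiples
  change ∫⁻ f in Set.Ioc 0 (2 * Real.pi), H (f - a) = _
  -- Passing to the open interval discards the endpoint `2π`, which reduction modulo `2π` sends to
  -- `0`.
  rw [h1, h2, zero_add, ← setLIntegral_congr Ioo_ae_eq_Ioc, ← setLIntegral_congr Ioo_ae_eq_Ioc]
  refine setLIntegral_congr_fun measurableSet_Ioo fun x hx => ?_
  simp only [hH]
  rw [(toIcoMod_eq_self Real.two_pi_pos).2]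
  rw [zero_add]
  exact ⟨hx.1.le, hx.2⟩

lemma measurable_toIcoMod_two_pi : Measurable (toIcoMod Real.two_pi_pos (0 : ℝ)) := by
  have : toIcoMod Real.two_pi_pos (0 : ℝ) =
      fun x => Int.fract (x / (2 * Real.pi)) * (2 * Real.pi) :=
    funext fun x => toIcoMod_eq_fract_mul Real.two_pi_pos x
  rw [this]
  fun_prop

lemma cos_toIcoMod (x : ℝ) : Real.cos (toIcoMod Real.two_pi_pos 0 x) = Real.cos x := by
  rw [toIcoMod, zsmul_eq_mul, Real.cos_sub_int_mul_two_pi]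

lemma twoWavePower_eq (V₁ V₂ f₁ f₂ : ℝ) : twoWavePower V₁ V₂ f₁ f₂ =
    V₁ ^ 2 + V₂ ^ 2 + 2 * V₁ * V₂ * Real.cos (f₂ - f₁) := by
  rw [twoWavePower, ← Complex.normSq_eq_norm_sq, Complex.normSq_apply, mul_comm Complex.I,
    mul_comm Complex.I, Complex.exp_mul_I, Complex.exp_mul_I, ← Complex.ofReal_cos,
    ← Complex.ofReal_cos, ← Complex.ofReal_sin, ← Complex.ofReal_sin, Real.cos_sub]
  simp only [Complex.add_re, Complex.add_im, Complex.mul_re, Complex.mul_im, Complex.ofReal_re,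
    Complex.ofReal_im, Complex.I_re, Complex.I_im]
  linear_combination V₁ ^ 2 * Real.sin_sq_add_cos_sq f₁ + V₂ ^ 2 * Real.sin_sq_add_cos_sq f₂

/-- The reflection `θ ↦ 2π - θ` exchanges the two halves of the period, so each contributes equally.
-/
lemma lintegral_ofReal_uniformPhase {f : ℝ → ℝ} (hf : ∀ θ, 0 ≤ f θ)
    (hsymm : ∀ θ, f (2 * Real.pi - θ) = f θ)
    (hint : IntervalIntegrable f volume 0 Real.pi) :
    ∫⁻ θ, ENNReal.ofReal (f θ) ∂uniformPhase =
      ENNReal.ofReal (1 / Real.pi * ∫ θ in (0 : ℝ)..Real.pi, f θ) := by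
  have hpi := Real.pi_pos
  have hint2 : IntervalIntegrable f volume Real.pi (2 * Real.pi) := by
    have := (hint.comp_sub_left (2 * Real.pi)).symm
    simp only [hsymm, sub_zero] at this
    rwa [show 2 * Real.pi - Real.pi = Real.pi by ring] at this
  have hrefl : ∫ θ in Real.pi..(2 * Real.pi), f θ = ∫ θ in (0 : ℝ)..Real.pi, f θ := by
    have := intervalIntegral.integral_comp_sub_left (a := 0) (b := Real.pi) f (2 * Real.pi)
    simp only [hsymm, sub_zero] at this
    rw [show 2 * Real.pi - Real.pi = Real.pi by ring] at this
    exact this.symm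
  have hI : ∫ θ in (0 : ℝ)..(2 * Real.pi), f θ = 2 * ∫ θ in (0 : ℝ)..Real.pi, f θ := by
    rw [← intervalIntegral.integral_add_adjacent_intervals hint hint2, hrefl, two_mul]
  have hle : (0 : ℝ) ≤ 2 * Real.pi := by positivity
  rw [lintegral_uniformPhase, ← ofReal_integral_eq_lintegral_ofReal
    ((intervalIntegrable_iff_integrableOn_Ioc_of_le hle).1 (hint.trans hint2))
    (ae_of_all _ hf), ← intervalIntegral.integral_of_le hle, hI,
    ← ENNReal.ofReal_inv_of_pos (by positivity), ← ENNReal.ofReal_mul (by positivity)]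
  congr 1
  field_simp

/-! ### Scaling and first moments -/

lemma lintegral_Ioi_eq_comp_mul {c : ℝ} (hc : 0 < c) {G : ℝ → ENNReal} (hG : Measurable G) :
    ∫⁻ x in Set.Ioi 0, G x = ∫⁻ w in Set.Ioi 0, ENNReal.ofReal c * G (c * w) := by
  have hm : Measurable (Set.indicator (Set.Ioi 0) G) := hG.indicator measurableSet_Ioi
  have hmap := lintegral_map (μ := volume) hm (measurable_const_mul c)
  have hscale : ∫⁻ x, Set.indicator (Set.Ioi 0) G x =
      ENNReal.ofReal c * ∫⁻ w, Set.indicator (Set.Ioi 0) G (c * w) := by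
    conv_lhs => rw [← Real.smul_map_volume_mul_left hc.ne']
    rw [lintegral_smul_measure, hmap, abs_of_pos hc, smul_eq_mul]
  rw [← lintegral_indicator measurableSet_Ioi, hscale,
    lintegral_const_mul' _ _ ENNReal.ofReal_ne_top,
    ← lintegral_indicator measurableSet_Ioi]
  congr 2
  funext w
  by_cases hw : 0 < w
  · rw [Set.indicator_of_mem (show c * w ∈ Set.Ioi 0 from mul_pos hc hw),
      Set.indicator_of_mem (show w ∈ Set.Ioi 0 from hw)]
  · rw [Set.indicator_of_notMem (show c * w ∉ Set.Ioi 0 from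
        fun h => hw ((mul_pos_iff_of_pos_left hc).1 h)),
      Set.indicator_of_notMem (show w ∉ Set.Ioi 0 from hw)]

/-- The mean is the derivative at zero of the explicit moment generating function. -/
lemma lintegral_id_kappaMu {μ p d : ℝ} (hμ : 0 < μ) (hp : 0 < p) (hd : 0 ≤ d) :
    ∫⁻ w, ENNReal.ofReal w ∂(kappaMu μ p d) = ENNReal.ofReal (μ * p + d) := by
  have hmem : 0 ∈ interior (integrableExpSet id (kappaMu μ p d)) := by
    have : Set.Iio (1 / p) ⊆ interior (integrableExpSet id (kappaMu μ p d)) :=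
      interior_maximal (fun t ht => integrable_exp_kappaMu hμ hp hd ht) isOpen_Iio
    exact this (show (0 : ℝ) < 1 / p by positivity)
  have hderiv : HasDerivAt (fun t => (1 / (1 - p * t)) ^ μ * Real.exp (d * t / (1 - p * t)))
      (μ * p + d) 0 := by
    have h1 : HasDerivAt (fun t => 1 - p * t) (-p) 0 := by
      simpa using ((hasDerivAt_id (0 : ℝ)).const_mul p).const_sub 1
    have h2 : HasDerivAt (fun t => 1 / (1 - p * t)) p 0 := by
      simpa using (hasDerivAt_const (0 : ℝ) (1 : ℝ)).fun_div h1 (by simp)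
    have h3 : HasDerivAt (fun t => (1 / (1 - p * t)) ^ μ) (μ * p) 0 := by
      have := h2.rpow_const (p := μ) (Or.inl (by simp))
      simpa [mul_comm] using this
    have h4 : HasDerivAt (fun t => d * t / (1 - p * t)) d 0 := by
      simpa using ((hasDerivAt_id (0 : ℝ)).const_mul d).fun_div h1 (by simp)
    simpa using h3.fun_mul h4.exp
  have hmean : ∫ w, id w ∂(kappaMu μ p d) = μ * p + d := by
    rw [← deriv_mgf_zero hmem]
    refine (hderiv.congr_of_eventuallyEq ?_).deriv
    filter_upwards [Iio_mem_nhds (show (0 : ℝ) < 1 / p by positivity)] with t ht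
    exact mgf_kappaMu hμ hp hd ht
  have hae : ∀ᵐ w ∂(kappaMu μ p d), 0 ≤ w := by
    have : ∀ᵐ w ∂(volume.restrict (Set.Ioi (0 : ℝ))), 0 ≤ w :=
      (ae_restrict_iff' measurableSet_Ioi).2 (ae_of_all _ fun w hw => le_of_lt hw)
    exact (withDensity_absolutelyContinuous _ _).ae_le this
  rw [← hmean]
  exact (ofReal_integral_eq_lintegral_ofReal
    (integrable_of_mem_interior_integrableExpSet hmem) hae).symm

lemma lintegral_id_gammaMeasure {m : ℝ} (hm : 0 < m) :
    ∫⁻ z, ENNReal.ofReal z ∂(gammaMeasure m m) = 1 := by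
  -- The series is cut to its constant term; the exponent `m + 1` absorbs the extra factor `z`.
  have key := lintegral_rpow_mul_series (a := m + 1) (b := m) (C := m ^ m / Real.Gamma m)
    (c := fun k => if k = 0 then 1 else 0) (by positivity) hm
    (by have := Real.Gamma_pos_of_pos hm; positivity) (fun k => by positivity)
    (fun x _ => summable_of_ne_finset_zero (s := {0}) fun k hk => by simp_all)
    (summable_of_ne_finset_zero (s := {0}) fun k hk => by simp_all)
  simp only [ite_mul, zero_mul, tsum_ite_eq, pow_zero, mul_one, one_mul, Nat.cast_zero,
    add_zero, add_sub_cancel_right] at key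
  rw [gammaMeasure, lintegral_withDensity_eq_lintegral_mul (f := gammaPDF m m) _
    (measurable_gammaPDFReal m m).ennreal_ofReal (by fun_prop)]
  have hsupp : ∀ x : ℝ, x ∉ Set.Ioi 0 → (gammaPDF m m * fun z => ENNReal.ofReal z) x = 0 := by
    intro x hx
    rw [Pi.mul_apply, ENNReal.ofReal_of_nonpos (by simpa using hx), mul_zero]
  rw [← setLIntegral_eq_of_support_subset (s := Set.Ioi 0)
    (fun x hx => by by_contra h; exact hx (hsupp x h))]
  have hG := Real.Gamma_pos_of_pos hm
  have h1 : m ^ m / Real.Gamma m * (1 / m) ^ (m + 1) * Real.Gamma (m + 1) = 1 := by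
    rw [Real.Gamma_add_one hm.ne', Real.rpow_add_one (by positivity), one_div,
      Real.inv_rpow hm.le]
    have : 0 < m ^ m := by positivity
    field_simp
  rw [h1, ENNReal.ofReal_one] at key
  rw [← key]
  refine setLIntegral_congr_fun measurableSet_Ioi fun z hz => ?_
  rw [Set.mem_Ioi] at hz
  rw [Pi.mul_apply, gammaPDF_of_nonneg hz.le, ← ENNReal.ofReal_mul (by positivity)]
  congr 1
  rw [Real.rpow_sub_one hz.ne']
  field_simp

/-! ### Joint law of phase difference and power in the generalized model -/

section Model

variable {P : Measure Ω} {μ V₁ V₂ S σ m : ℝ} {ζ φ₁ φ₂ W : Ω → ℝ}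

lemma two_mul_div_mem_Icc {V₁ V₂ S : ℝ} (hV₁ : 0 ≤ V₁) (hV₂ : 0 ≤ V₂) (hS : 0 ≤ S)
    (hT : 0 < V₁ ^ 2 + V₂ ^ 2 + S) :
    2 * V₁ * V₂ / (V₁ ^ 2 + V₂ ^ 2 + S) ∈ Set.Icc (0 : ℝ) 1 := by
  refine ⟨by positivity, ?_⟩
  rw [div_le_one hT]
  nlinarith [sq_nonneg (V₁ - V₂)]

lemma kappa_nonneg {K Δ : ℝ} (hK : 0 ≤ K) (hΔ : Δ ∈ Set.Icc (0 : ℝ) 1) (θ : ℝ) :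
    0 ≤ kappa K Δ θ :=
  mul_nonneg hK (one_add_mul_cos_nonneg hΔ.1 hΔ.2 θ)

/-- The total dominant power depends on the phases only through their difference. -/
lemma twoWavePower_add {K Δ f₁ f₂ : ℝ} (hσ : 0 < σ) (hμ : 0 < μ)
    (hT : 0 < V₁ ^ 2 + V₂ ^ 2 + S) (hK : K = (V₁ ^ 2 + V₂ ^ 2 + S) / (2 * σ ^ 2 * μ))
    (hΔ : Δ = 2 * V₁ * V₂ / (V₁ ^ 2 + V₂ ^ 2 + S)) :
    twoWavePower V₁ V₂ f₁ f₂ + S =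
      μ * kappa K Δ (toIcoMod Real.two_pi_pos 0 (f₂ - f₁)) * (2 * σ ^ 2) := by
  rw [twoWavePower_eq, kappa, cos_toIcoMod, hK, hΔ]
  field_simp
  ring

variable {K Δ : ℝ}

/-- Averaging over the two phases amounts to averaging over their difference. -/
lemma GeneralizedModel.lintegral_eq_phase (h : GeneralizedModel P μ V₁ V₂ S σ m ζ φ₁ φ₂ W)
    (hμ : 0 < μ) (hm : 0 < m) (hσ : 0 < σ) (hT : 0 < V₁ ^ 2 + V₂ ^ 2 + S)
    (hK : K = (V₁ ^ 2 + V₂ ^ 2 + S) / (2 * σ ^ 2 * μ))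
    (hΔ : Δ = 2 * V₁ * V₂ / (V₁ ^ 2 + V₂ ^ 2 + S))
    {F : ℝ × ℝ → ENNReal} (hF : Measurable F) :
    ∫⁻ ω, F (toIcoMod Real.two_pi_pos 0 (φ₂ ω - φ₁ ω), W ω) ∂P =
      ∫⁻ z, ∫⁻ θ, ∫⁻ w in Set.Ioi 0, ENNReal.ofReal (kappaMuPDF μ (2 * σ ^ 2)
        (z * (μ * kappa K Δ θ * (2 * σ ^ 2))) w) * F (θ, w)
        ∂volume ∂uniformPhase ∂(gammaMeasure m m) := by
  have hmod := measurable_toIcoMod_two_pi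
  have hF' : Measurable fun q : ℝ × ℝ × ℝ × ℝ =>
      F (toIcoMod Real.two_pi_pos 0 (q.2.2.1 - q.2.1), q.2.2.2) :=
    hF.comp ((hmod.comp (by fun_prop)).prodMk (by fun_prop))
  rw [h.lintegral_eq hμ hm hF']
  refine lintegral_congr fun z => ?_
  simp_rw [twoWavePower_add hσ hμ hT hK hΔ]
  -- For fixed `f₁`, rotation invariance in `f₂` makes the inner integral independent of `f₁`.
  rw [lintegral_congr fun f₁ => lintegral_toIcoMod_sub (fun θ => ∫⁻ w in Set.Ioi 0,
    ENNReal.ofReal (kappaMuPDF μ (2 * σ ^ 2) (z * (μ * kappa K Δ θ * (2 * σ ^ 2))) w) *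
      F (θ, w)) f₁, lintegral_const, measure_univ, mul_one]

/-- The joint law of the phase difference and the SNR, in integrated form. -/
lemma GeneralizedModel.lintegral_condPDF (h : GeneralizedModel P μ V₁ V₂ S σ m ζ φ₁ φ₂ W)
    (hμ : 0 < μ) (hm : 0 < m) (hσ : 0 < σ) (hT : 0 < V₁ ^ 2 + V₂ ^ 2 + S)
    (hK : K = (V₁ ^ 2 + V₂ ^ 2 + S) / (2 * σ ^ 2 * μ))
    (hΔ : Δ = 2 * V₁ * V₂ / (V₁ ^ 2 + V₂ ^ 2 + S)) (hΔ' : Δ ∈ Set.Icc (0 : ℝ) 1)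
    {c gbar : ℝ} (hc : 0 < c) (hg : gbar = c * (2 * σ ^ 2) * (μ * (1 + K)))
    {F : ℝ × ℝ → ENNReal} (hF : Measurable F) :
    ∫⁻ ω, F (toIcoMod Real.two_pi_pos 0 (φ₂ ω - φ₁ ω), c * W ω) ∂P =
      ∫⁻ θ, ∫⁻ x in Set.Ioi 0, ENNReal.ofReal (condPDF K m μ Δ gbar θ x) * F (θ, x)
        ∂volume ∂uniformPhase := by
  have := isProbabilityMeasure_gammaMeasure hm hm
  have hp : 0 < 2 * σ ^ 2 := by positivity
  have hK0 : 0 ≤ K := by rw [hK]; positivity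
  have hκ := kappa_nonneg hK0 hΔ'
  have hg0 : 0 < gbar := by rw [hg]; positivity
  have hgq : gbar / (μ * (1 + K)) = c * (2 * σ ^ 2) := by rw [hg]; field_simp
  have hFc : Measurable fun q : ℝ × ℝ => F (q.1, c * q.2) := hF.comp (by fun_prop)
  have hkappa : Measurable (kappa K Δ) := by unfold kappa; fun_prop
  have hjoint : Measurable fun q : (ℝ × ℝ) × ℝ => ENNReal.ofReal (kappaMuPDF μ (2 * σ ^ 2)
        (q.1.1 * (μ * kappa K Δ q.1.2 * (2 * σ ^ 2))) q.2) * F (q.1.2, c * q.2) :=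
    (((measurable_kappaMuPDF (p := 2 * σ ^ 2) hμ).comp (by fun_prop :
      Measurable fun q : (ℝ × ℝ) × ℝ =>
        (q.1.1 * (μ * kappa K Δ q.1.2 * (2 * σ ^ 2)), q.2))).ennreal_ofReal).mul
      (hFc.comp (by fun_prop : Measurable fun q : (ℝ × ℝ) × ℝ => (q.1.2, q.2)))
  -- This Tonelli swap and the next bring the shadowing integral innermost, where it turns the κ-μ
  -- density into the shadowed one.
  rw [h.lintegral_eq_phase hμ hm hσ hT hK hΔ hFc, lintegral_lintegral_swap]
  swap
  · exact hjoint.lintegral_prod_right'.aemeasurable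
  refine lintegral_congr fun θ => ?_
  rw [lintegral_lintegral_swap]
  swap
  · exact (hjoint.comp (by fun_prop : Measurable fun q : ℝ × ℝ => ((q.1, θ), q.2))).aemeasurable
  have hG : Measurable fun x => ENNReal.ofReal (condPDF K m μ Δ gbar θ x) * F (θ, x) :=
    ((measurable_condPDF K m Δ gbar hμ).comp (by fun_prop :
      Measurable fun x : ℝ => (θ, x))).ennreal_ofReal.mul (hF.comp (by fun_prop))
  rw [lintegral_Ioi_eq_comp_mul hc hG]
  refine setLIntegral_congr_fun measurableSet_Ioi fun w hw => ?_
  rw [Set.mem_Ioi] at hw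
  have hkm : Measurable fun z => ENNReal.ofReal (kappaMuPDF μ (2 * σ ^ 2)
      (z * (μ * kappa K Δ θ * (2 * σ ^ 2))) w) :=
    ((measurable_kappaMuPDF (p := 2 * σ ^ 2) hμ).comp (by fun_prop : Measurable fun z : ℝ =>
        (z * (μ * kappa K Δ θ * (2 * σ ^ 2)), w))).ennreal_ofReal
  have hs : 0 ≤ μ * kappa K Δ θ := mul_nonneg hμ.le (hκ θ)
  rw [lintegral_mul_const _ hkm, lintegral_kappaMuPDF_gamma_eq_shadowedPDF hμ hp hs hm hw,
    ← mul_assoc, ← ENNReal.ofReal_mul hc.le,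
    condPDF_eq_shadowedPDF hm hμ hK0 hg0 (hκ θ) (by positivity), hgq,
    mul_shadowedPDF_mul hc hp hw]

lemma GeneralizedModel.aemeasurable (h : GeneralizedModel P μ V₁ V₂ S σ m ζ φ₁ φ₂ W) :
    AEMeasurable W P ∧ AEMeasurable (fun ω => toIcoMod Real.two_pi_pos 0 (φ₂ ω - φ₁ ω)) P := by
  have hq := h.law.aemeasurable
  exact ⟨hq.snd.snd.snd, measurable_toIcoMod_two_pi.comp_aemeasurable
    (hq.snd.snd.fst.sub hq.snd.fst)⟩

lemma integral_affine_cos (a b Δ : ℝ) :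
    1 / Real.pi * ∫ θ in (0 : ℝ)..Real.pi, (a + b * (1 + Δ * Real.cos θ)) = a + b := by
  have h1 : IntervalIntegrable (fun θ => b * Δ * Real.cos θ) volume 0 Real.pi :=
    (by fun_prop : Continuous fun θ => b * Δ * Real.cos θ).intervalIntegrable _ _
  have h2 : ∀ θ, a + b * (1 + Δ * Real.cos θ) = (a + b) + b * Δ * Real.cos θ := fun θ => by ring
  simp_rw [h2]
  rw [intervalIntegral.integral_add (by simp) h1, intervalIntegral.integral_const_mul,
    integral_cos, intervalIntegral.integral_const]
  have := Real.pi_ne_zero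
  simp only [Real.sin_pi, Real.sin_zero, sub_zero, mul_zero, add_zero, smul_eq_mul]
  field_simp

/-- The mean received power. -/
lemma GeneralizedModel.integral_eq (h : GeneralizedModel P μ V₁ V₂ S σ m ζ φ₁ φ₂ W)
    (hμ : 0 < μ) (hm : 0 < m) (hσ : 0 < σ) (hT : 0 < V₁ ^ 2 + V₂ ^ 2 + S)
    (hK : K = (V₁ ^ 2 + V₂ ^ 2 + S) / (2 * σ ^ 2 * μ))
    (hΔ : Δ = 2 * V₁ * V₂ / (V₁ ^ 2 + V₂ ^ 2 + S)) (hΔ' : Δ ∈ Set.Icc (0 : ℝ) 1) :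
    ∫ ω, W ω ∂P = 2 * σ ^ 2 * (μ * (1 + K)) := by
  have := isProbabilityMeasure_gammaMeasure hm hm
  have hp : 0 < 2 * σ ^ 2 := by positivity
  have hK0 : 0 ≤ K := by rw [hK]; positivity
  have hκ := kappa_nonneg hK0 hΔ'
  -- Tested on the indicator of the negative half-line; this is needed to pass from the Bochner
  -- integral to the Lebesgue integral.
  have hae : ∀ᵐ ω ∂P, 0 ≤ W ω := by
    have hind : Measurable fun q : ℝ × ℝ => Set.indicator (Set.Iio (0 : ℝ)) (1 : ℝ → ENNReal) q.2 :=
      (measurable_one.indicator measurableSet_Iio).comp measurable_snd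
    have h0 := h.lintegral_eq_phase hμ hm hσ hT hK hΔ hind
    have hinner : ∀ z θ : ℝ, ∫⁻ w in Set.Ioi 0, ENNReal.ofReal (kappaMuPDF μ (2 * σ ^ 2)
        (z * (μ * kappa K Δ θ * (2 * σ ^ 2))) w) *
          Set.indicator (Set.Iio (0 : ℝ)) (1 : ℝ → ENNReal) w = 0 := by
      intro z θ
      rw [setLIntegral_congr_fun (g := fun _ => 0) measurableSet_Ioi, lintegral_zero]
      intro w hw
      dsimp only
      rw [Set.indicator_of_notMem (show w ∉ Set.Iio 0 from
        not_lt.2 (le_of_lt (Set.mem_Ioi.1 hw))), mul_zero]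
    simp only [hinner, lintegral_zero] at h0
    have hind' : AEMeasurable
        (fun ω => Set.indicator (Set.Iio (0 : ℝ)) (1 : ℝ → ENNReal) (W ω)) P :=
      (measurable_one.indicator measurableSet_Iio).comp_aemeasurable h.aemeasurable.1
    rw [lintegral_eq_zero_iff' hind'] at h0
    refine h0.mono fun ω hω => ?_
    by_contra hcon
    simp only [Pi.zero_apply] at hω
    rw [Set.indicator_of_mem (show W ω ∈ Set.Iio 0 from not_le.1 hcon)] at hω
    exact one_ne_zero hω
  rw [integral_eq_lintegral_of_nonneg_ae hae h.aemeasurable.1.aestronglyMeasurable,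
    h.lintegral_eq_phase (F := fun q => ENNReal.ofReal q.2) hμ hm hσ hT hK hΔ (by fun_prop)]
  -- The conditional mean `μ p + d` is affine in `cos θ`, so averaging over the phase removes `Δ`.
  have hinner : ∀ z : ℝ, 0 ≤ z → ∫⁻ θ, ∫⁻ w in Set.Ioi 0, ENNReal.ofReal
      (kappaMuPDF μ (2 * σ ^ 2) (z * (μ * kappa K Δ θ * (2 * σ ^ 2))) w) * ENNReal.ofReal w
      ∂volume ∂uniformPhase = ENNReal.ofReal (μ * (2 * σ ^ 2)) +
        ENNReal.ofReal (μ * K * (2 * σ ^ 2)) * ENNReal.ofReal z := by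
    intro z hz
    have hd : ∀ θ, 0 ≤ z * (μ * kappa K Δ θ * (2 * σ ^ 2)) := fun θ => by
      have := hκ θ
      positivity
    have h1 : ∀ θ, ∫⁻ w in Set.Ioi 0, ENNReal.ofReal
      (kappaMuPDF μ (2 * σ ^ 2) (z * (μ * kappa K Δ θ * (2 * σ ^ 2))) w) * ENNReal.ofReal w =
        ENNReal.ofReal (μ * (2 * σ ^ 2) + μ * K * (2 * σ ^ 2) * z * (1 + Δ * Real.cos θ)) := by
      intro θ
      rw [← lintegral_kappaMu hμ (by fun_prop), lintegral_id_kappaMu hμ hp (hd θ), kappa]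
      congr 1
      ring
    simp_rw [h1]
    rw [lintegral_ofReal_uniformPhase, integral_affine_cos,
      ENNReal.ofReal_add (by positivity) (by positivity), ENNReal.ofReal_mul' hz]
    · intro θ
      have := one_add_mul_cos_nonneg hΔ'.1 hΔ'.2 θ
      positivity
    · intro θ
      rw [Real.cos_two_pi_sub]
    · exact (by fun_prop : Continuous fun θ => μ * (2 * σ ^ 2) + μ * K * (2 * σ ^ 2) * z *
        (1 + Δ * Real.cos θ)).intervalIntegrable _ _
  rw [lintegral_congr_ae ((ae_nonneg_gammaMeasure m m).mono hinner),
    lintegral_add_left measurable_const, lintegral_const, measure_univ, mul_one,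
    lintegral_const_mul _ (by fun_prop), lintegral_id_gammaMeasure hm, mul_one,
    ← ENNReal.ofReal_add (by positivity) (by positivity), ENNReal.toReal_ofReal (by positivity)]
  ring

end Model

/-! ### The MFTR variable and averages of the conditional PDF and CDF -/

lemma condPDF_two_pi_sub (K m μ Δ gbar θ x : ℝ) :
    condPDF K m μ Δ gbar (2 * Real.pi - θ) x = condPDF K m μ Δ gbar θ x := by
  simp only [condPDF, Real.cos_two_pi_sub]

lemma condCDF_two_pi_sub (K m μ Δ gbar θ x : ℝ) :
    condCDF K m μ Δ gbar (2 * Real.pi - θ) x = condCDF K m μ Δ gbar θ x := by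
  simp only [condCDF, Real.cos_two_pi_sub]

/-- An MFTR variable, whichever model it comes from, has a phase difference and an SNR with the
joint density `condPDF`, here in integrated form. -/
lemma IsMFTR.lintegral_condPDF {P : Measure Ω}
    {γ α : Ω → ℝ} {K m μ Δ gbar : ℝ} (h : IsMFTR P γ α K m μ Δ gbar) :
    0 < m ∧ 0 < μ ∧ 0 ≤ K ∧ Δ ∈ Set.Icc (0 : ℝ) 1 ∧ 0 < gbar ∧ AEMeasurable γ P ∧
      AEMeasurable α P ∧ ∀ F : ℝ × ℝ → ENNReal, Measurable F →
        ∫⁻ ω, F (α ω, γ ω) ∂P = ∫⁻ θ, ∫⁻ x in Set.Ioi 0,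
          ENNReal.ofReal (condPDF K m μ Δ gbar θ x) * F (θ, x) ∂volume ∂uniformPhase := by
  obtain ⟨V₁, V₂, S, σ, Es, N₀, ζ, φ₁, φ₂, W, hm, hμ, hV₁, hV₂, hS, hT, hσ, hEs, hN₀, hK, hΔ, hγ,
    hα, hgbar, hmodel⟩ := h
  have hgen : GeneralizedModel P μ V₁ V₂ S σ m ζ φ₁ φ₂ W := by
    rcases hmodel with ⟨k, U, φ, X, Y, rfl, -, rfl, hc⟩ | hg
    · exact hc.generalizedModel hσ hm
    · exact hg
  have hK0 : 0 ≤ K := by rw [hK]; positivity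
  have hΔ' : Δ ∈ Set.Icc (0 : ℝ) 1 := hΔ ▸ two_mul_div_mem_Icc hV₁ hV₂ hS hT
  have hc : 0 < Es / N₀ := by positivity
  obtain rfl : γ = fun ω => Es / N₀ * W ω := funext hγ
  obtain rfl : α = fun ω => toIcoMod Real.two_pi_pos 0 (φ₂ ω - φ₁ ω) := funext hα
  have hg : gbar = Es / N₀ * (2 * σ ^ 2) * (μ * (1 + K)) := by
    rw [hgbar, integral_const_mul, hgen.integral_eq hμ hm hσ hT hK hΔ hΔ']
    ring
  refine ⟨hm, hμ, hK0, hΔ', by rw [hg]; positivity, hgen.aemeasurable.1.const_mul _,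
    hgen.aemeasurable.2, fun F hF => ?_⟩
  exact hgen.lintegral_condPDF hμ hm hσ hT hK hΔ hΔ' hc hg hF

lemma intervalIntegrable_condPDF {K m μ Δ gbar : ℝ} (hm : 0 < m) (hμ : 0 < μ)
    (hκ : ∀ θ, 0 ≤ kappa K Δ θ) (x : ℝ) :
    IntervalIntegrable (fun θ => condPDF K m μ Δ gbar θ x) volume 0 Real.pi :=
  (continuous_condPDF hm hμ hκ x).intervalIntegrable _ _

section Averages

variable {K m μ Δ gbar : ℝ} (hm : 0 < m) (hμ : 0 < μ) (hK : 0 ≤ K) (hg : 0 < gbar)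
  (hκ : ∀ θ, 0 ≤ kappa K Δ θ)
include hm hμ hK hg hκ

lemma intervalIntegrable_condCDF {x : ℝ} (hx : 0 ≤ x) :
    IntervalIntegrable (fun θ => condCDF K m μ Δ gbar θ x) volume 0 Real.pi := by
  refine (intervalIntegrable_const (c := (1 : ℝ))).mono_fun
    (measurable_condCDF hm hμ hK hg hκ hx).aestronglyMeasurable (ae_of_all _ fun θ => ?_)
  dsimp only
  rw [Real.norm_of_nonneg (condCDF_nonneg hm hμ hK hg (hκ θ) hx), norm_one]
  exact condCDF_le_one hm hμ hK hg (hκ θ) hx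

lemma lintegral_condPDF_uniformPhase {x : ℝ} (hx : 0 < x) :
    ∫⁻ θ, ENNReal.ofReal (condPDF K m μ Δ gbar θ x) ∂uniformPhase =
      ENNReal.ofReal (1 / Real.pi * ∫ θ in (0 : ℝ)..Real.pi, condPDF K m μ Δ gbar θ x) :=
  lintegral_ofReal_uniformPhase (fun θ => condPDF_nonneg hm hμ hK hg (hκ θ) hx.le)
    (fun θ => condPDF_two_pi_sub K m μ Δ gbar θ x) (intervalIntegrable_condPDF hm hμ hκ x)

lemma lintegral_condPDF_Ioc_uniformPhase {x : ℝ} (hx : 0 ≤ x) :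
    (∫⁻ θ, ∫⁻ w in Set.Ioc 0 x, ENNReal.ofReal (condPDF K m μ Δ gbar θ w)
      ∂volume ∂uniformPhase).toReal =
      1 / Real.pi * ∫ θ in (0 : ℝ)..Real.pi, condCDF K m μ Δ gbar θ x := by
  have h1 : ∀ θ, ∫⁻ w in Set.Ioc 0 x, ENNReal.ofReal (condPDF K m μ Δ gbar θ w) =
      ENNReal.ofReal (condCDF K m μ Δ gbar θ x) := fun θ =>
    lintegral_condPDF_Ioc hm hμ hK hg (hκ θ) hx
  rw [lintegral_congr h1, lintegral_ofReal_uniformPhase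
    (fun θ => condCDF_nonneg hm hμ hK hg (hκ θ) hx)
    (fun θ => condCDF_two_pi_sub K m μ Δ gbar θ x) (intervalIntegrable_condCDF hm hμ hK hg hκ hx),
    ENNReal.toReal_ofReal]
  exact mul_nonneg (by positivity) (intervalIntegral.integral_nonneg Real.pi_pos.le fun θ _ =>
    condCDF_nonneg hm hμ hK hg (hκ θ) hx)

end Averages

/-! ### Laws read off from the test-function identity -/

section Laws

variable {P : Measure Ω} {γ α : Ω → ℝ} {f : ℝ × ℝ → ENNReal} {ν : Measure ℝ}
  (hγ : AEMeasurable γ P) (hα : AEMeasurable α P) (hf : Measurable f)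
  (hlaw : ∀ F : ℝ × ℝ → ENNReal, Measurable F →
    ∫⁻ ω, F (α ω, γ ω) ∂P = ∫⁻ θ, ∫⁻ x in Set.Ioi 0, f (θ, x) * F (θ, x) ∂volume ∂ν)

include hγ hf hlaw

lemma hasLaw_of_lintegral_eq [SFinite ν] :
    HasLaw γ ((volume.restrict (Set.Ioi 0)).withDensity fun x => ∫⁻ θ, f (θ, x) ∂ν) P := by
  refine ⟨hγ, Measure.ext_of_lintegral _ fun F hF => ?_⟩
  have hF' : Measurable fun q : ℝ × ℝ => F q.2 := hF.comp measurable_snd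
  rw [lintegral_map' hF.aemeasurable hγ,
    lintegral_withDensity_eq_lintegral_mul _ hf.lintegral_prod_left' hF,
    hlaw (fun q => F q.2) hF', lintegral_lintegral_swap (hf.mul hF').aemeasurable]
  refine lintegral_congr fun x => ?_
  have hx : Measurable fun θ => f (θ, x) := hf.comp (measurable_prodMk_right (y := x))
  exact lintegral_mul_const (F x) hx

include hα in
lemma hasLaw_prod_of_lintegral_eq : HasLaw (fun ω => (α ω, γ ω))
    ((ν.prod (volume.restrict (Set.Ioi 0))).withDensity f) P := by
  refine ⟨hα.prodMk hγ, Measure.ext_of_lintegral _ fun F hF => ?_⟩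
  rw [lintegral_map' hF.aemeasurable (hα.prodMk hγ), hlaw F hF,
    lintegral_withDensity_eq_lintegral_mul _ hf hF, lintegral_prod _ (hf.mul hF).aemeasurable]
  rfl

/-- No sign is imposed on `x`: for negative `x` the interval is empty, which also gives the
vanishing of the CDF there. -/
lemma measure_le_of_lintegral_eq [SFinite ν] (x : ℝ) :
    P {ω | γ ω ≤ x} = ∫⁻ θ, ∫⁻ w in Set.Ioc 0 x, f (θ, w) ∂volume ∂ν := by
  have h := hasLaw_of_lintegral_eq hγ hf hlaw
  rw [h.measure_eq (p := fun y => y ≤ x) measurableSet_Iic]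
  change (Measure.withDensity _ _) (Set.Iic x) = _
  rw [withDensity_apply _ measurableSet_Iic, Measure.restrict_restrict measurableSet_Iic,
    Set.inter_comm, Set.Ioi_inter_Iic]
  exact (lintegral_lintegral_swap (f := fun θ w => f (θ, w)) hf.aemeasurable).symm

end Laws

end MFTR

theorem lemma3 {Ω : Type*} [MeasurableSpace Ω] (P : Measure Ω) [IsProbabilityMeasure P]
    (γ α : Ω → ℝ) (K m μ Δ gbar : ℝ) (h : MFTR.IsMFTR P γ α K m μ Δ gbar) :
    -- the PDF of the SNR is the average over `θ` of the conditional PDF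
    (∀ x : ℝ, 0 < x →
      IntervalIntegrable (fun θ => MFTR.condPDF K m μ Δ gbar θ x) volume 0 Real.pi) ∧
    HasLaw γ ((volume.restrict (Set.Ioi 0)).withDensity fun x =>
      ENNReal.ofReal (1 / Real.pi * ∫ θ in (0 : ℝ)..Real.pi, MFTR.condPDF K m μ Δ gbar θ x)) P ∧
    -- the CDF of the SNR is the average over `θ` of the conditional CDF
    (∀ x : ℝ, 0 ≤ x →
      IntervalIntegrable (fun θ => MFTR.condCDF K m μ Δ gbar θ x) volume 0 Real.pi ∧
      P.real {ω | γ ω ≤ x} =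
        1 / Real.pi * ∫ θ in (0 : ℝ)..Real.pi, MFTR.condCDF K m μ Δ gbar θ x) ∧
    (∀ x : ℝ, x < 0 → P.real {ω | γ ω ≤ x} = 0) ∧
    -- `condPDF` is the conditional PDF of the SNR given the phase difference, which is uniform
    HasLaw (fun ω => (α ω, γ ω))
      ((MFTR.uniformPhase.prod (volume.restrict (Set.Ioi 0))).withDensity fun q : ℝ × ℝ =>
        ENNReal.ofReal (MFTR.condPDF K m μ Δ gbar q.1 q.2)) P ∧
    -- for each `θ`, `condPDF` and `condCDF` are the PDF and the CDF of the κ-μ shadowed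
    -- distribution with parameters `κ_θ`, `μ`, `m` and mean `gbar * (1 + κ_θ) / (1 + K)`
    (∀ θ : ℝ,
      MFTR.kappaMuShadowed (MFTR.kappa K Δ θ) μ m (gbar * (1 + MFTR.kappa K Δ θ) / (1 + K)) =
        (volume.restrict (Set.Ioi 0)).withDensity
          (fun x => ENNReal.ofReal (MFTR.condPDF K m μ Δ gbar θ x)) ∧
      ∀ x : ℝ, 0 ≤ x →
        (MFTR.kappaMuShadowed (MFTR.kappa K Δ θ) μ m
          (gbar * (1 + MFTR.kappa K Δ θ) / (1 + K))).real (Set.Iic x) =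
          MFTR.condCDF K m μ Δ gbar θ x) := by
  obtain ⟨hm, hμ, hK, hΔ, hg, hγm, hαm, hlaw⟩ := h.lintegral_condPDF
  have hκ := MFTR.kappa_nonneg hK hΔ
  set f : ℝ × ℝ → ENNReal := fun q => ENNReal.ofReal (MFTR.condPDF K m μ Δ gbar q.1 q.2)
  have hpdfm : Measurable f := (MFTR.measurable_condPDF K m Δ gbar hμ).ennreal_ofReal
  refine ⟨fun x _ => MFTR.intervalIntegrable_condPDF hm hμ hκ x, ?_,
    fun x hx => ⟨MFTR.intervalIntegrable_condCDF hm hμ hK hg hκ hx, ?_⟩, fun x hx => ?_,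
    MFTR.hasLaw_prod_of_lintegral_eq hγm hαm hpdfm hlaw, fun θ => ⟨?_, fun x hx => ?_⟩⟩
  · have hdens : (fun x => ENNReal.ofReal
        (1 / Real.pi * ∫ θ in (0 : ℝ)..Real.pi, MFTR.condPDF K m μ Δ gbar θ x))
        =ᵐ[volume.restrict (Set.Ioi 0)] fun x =>
          ∫⁻ θ, ENNReal.ofReal (MFTR.condPDF K m μ Δ gbar θ x) ∂MFTR.uniformPhase :=
      (ae_restrict_iff' measurableSet_Ioi).2 (ae_of_all _ fun x hx =>
        (MFTR.lintegral_condPDF_uniformPhase hm hμ hK hg hκ hx).symm)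
    rw [withDensity_congr_ae hdens]
    exact MFTR.hasLaw_of_lintegral_eq (f := f) hγm hpdfm hlaw
  · rw [measureReal_def, MFTR.measure_le_of_lintegral_eq (f := f) hγm hpdfm hlaw]
    exact MFTR.lintegral_condPDF_Ioc_uniformPhase hm hμ hK hg hκ hx
  · rw [measureReal_def, MFTR.measure_le_of_lintegral_eq (f := f) hγm hpdfm hlaw,
      Set.Ioc_eq_empty (not_lt.2 hx.le)]
    simp
  · exact MFTR.kappaMuShadowed_eq_condPDF hm hμ hK hg (hκ θ)
  · rw [measureReal_def, MFTR.kappaMuShadowed_Iic hm hμ hK hg (hκ θ) hx,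
      ENNReal.toReal_ofReal (MFTR.condCDF_nonneg hm hμ hK hg (hκ θ) hx)]
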